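/- Let $n\ge 1$ and $0<\alpha<1$. Let $\psi$ be a (complex-valued) Schwartz function on $\mathbb{R}^n$ with $\operatorname{supp}\hat\psi\subset\{\xi:\tfrac12\le|\xi|\le 2\}$ and $\sum_{j\in\mathbb{Z}}\hat\psi_j(\xi)=1$ for all $\xi\neq 0$, where $\psi_j(x)=2^{jn}\psi(2^jx)$ and $\hat\psi(\xi)=\int\psi(x)e^{-2\pi i x\cdot\xi}\,dx$; put $\Delta_jf=\psi_j*f$. For $f\in L^2(\mathbb{R}^n)$ (complex-valued) define, with values in $[0,\infty]$, $$\|f\|_{Q_\alpha}=\Big(\sup_I\, l(I)^{2\alpha-n}\int_I\int_I\frac{|f(x)-f(y)|^2}{|x-y|^{2\alpha+n}}\,dx\,dy\Big)^{1/2},$$ $$\|f\|_{\mathcal{L}^{2,n-2\alpha,\alpha}}=\Big(\sup_I\,\frac{1}{|I|^{1-2\alpha/n}}\sum_{j\in\mathbb{Z},\ j\ge-\log_2 l(I)}2^{2\alpha j}\|\Delta_jf\|_{L^2(I)}^2\Big)^{1/2},$$ where the suprema run over all cubes $I\subset\mathbb{R}^n$ with edges parallel to the coordinate axes, of edge length $l(I)>0$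 and volume $|I|$. Then there is a constant $C>0$, depending only on $n$, $\alpha$ and the fixed function $\psi$, such that for every $f\in L^2(\mathbb{R}^n)$ $$\|f\|_{Q_\alpha}\le C\,\|f\|_{\mathcal{L}^{2,n-2\alpha,\alpha}}\qquad\text{and}\qquad\|f\|_{\mathcal{L}^{2,n-2\alpha,\alpha}}\le C\,\|f\|_{Q_\alpha}.$$ In particular, a function $f\in L^2(\mathbb{R}^n)$ satisfies $\|f\|_{Q_\alpha}<\infty$ if and only if $\|f\|_{\mathcal{L}^{2,n-2\alpha,\alpha}}<\infty$; that is, $Q_\alpha(\mathbb{R}^n)\cap L^2(\mathbb{R}^n)=\mathcal{L}^{2,n-2\alpha,\alpha}\cap L^2(\mathbb{R}^n)$. -/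

import Mathlib

open scoped ENNReal NNReal FourierTransform SchwartzMap Convolution

namespace QSpace

/-- Euclidean space `ℝⁿ`. -/
abbrev E (n : ℕ) : Type := EuclideanSpace ℝ (Fin n)

/-- A (nondegenerate) cube in `ℝⁿ` with edges parallel to the coordinate axes, given by its lower
corner and its edge length `l(I) > 0`. -/
structure Cube (n : ℕ) where
  corner : E n
  side : ℝ
  side_pos : 0 < side

/-- The set of points of a cube. -/
def Cube.toSet {n : ℕ} (I : Cube n) : Set (E n) :=
  {x | ∀ i, I.corner i ≤ x i ∧ x i ≤ I.corner i + I.side}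

/-- The norm `‖f‖_{Q_α}`, with values in `[0, ∞]`:
the square root of `sup_I l(I)^(2α-n) ∫_I ∫_I |f(x)-f(y)|² / |x-y|^(2α+n) dx dy`.
On the diagonal the integrand is `0 / 0 = 0`. -/
noncomputable def qNorm {n : ℕ} (α : ℝ) (f : E n → ℂ) : ℝ≥0∞ :=
  (⨆ I : Cube n, ENNReal.ofReal (I.side ^ (2 * α - (n : ℝ))) *
    ∫⁻ x in I.toSet, ∫⁻ y in I.toSet,
      ‖f x - f y‖ₑ ^ 2 / ENNReal.ofReal (‖x - y‖ ^ (2 * α + (n : ℝ)))) ^ (1 / 2 : ℝ)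

/-- The dilate `ψ_j(x) = 2^(jn) ψ(2^j x)`. -/
noncomputable def dilate {n : ℕ} (ψ : 𝓢(E n, ℂ)) (j : ℤ) (x : E n) : ℂ :=
  (2 : ℂ) ^ (j * (n : ℤ)) * ψ ((2 : ℝ) ^ j • x)

/-- `ψ` generates a homogeneous Littlewood-Paley decomposition: the Fourier transform of `ψ` is
supported in the annulus `1/2 ≤ |ξ| ≤ 2`, and the Fourier transforms of the dilates `ψ_j`, `j ∈ ℤ`,
sum to `1` at each `ξ ≠ 0` (at `ξ = 0` all of them vanish). -/
structure IsLittlewoodPaley {n : ℕ} (ψ : 𝓢(E n, ℂ)) : Prop where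
  tsupport_fourier_subset :
    tsupport (𝓕 (ψ : E n → ℂ)) ⊆ {ξ : E n | 1 / 2 ≤ ‖ξ‖ ∧ ‖ξ‖ ≤ 2}
  hasSum_fourier : ∀ ξ : E n, ξ ≠ 0 → HasSum (fun j : ℤ => 𝓕 (dilate ψ j) ξ) 1

/-- The Littlewood-Paley operator `Δ_j f = ψ_j * f`. -/
noncomputable def lpOp {n : ℕ} (ψ : 𝓢(E n, ℂ)) (j : ℤ) (f : E n → ℂ) : E n → ℂ :=
  dilate ψ j ⋆[ContinuousLinearMap.mul ℂ ℂ, MeasureTheory.volume] f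

/-- The norm of `𝓛^{2, n-2α, α}`, with values in `[0, ∞]`: the square root of
`sup_I |I|^(-(1-2α/n)) ∑_{j ≥ -log₂ l(I)} 2^(2αj) ‖Δ_j f‖²_{L²(I)}`. -/
noncomputable def lpNorm {n : ℕ} (ψ : 𝓢(E n, ℂ)) (α : ℝ) (f : E n → ℂ) : ℝ≥0∞ :=
  (⨆ I : Cube n, (1 / MeasureTheory.volume I.toSet ^ (1 - 2 * α / (n : ℝ))) *
    ∑' j : {j : ℤ // -Real.logb 2 I.side ≤ (j : ℝ)},
      ENNReal.ofReal ((2 : ℝ) ^ (2 * α * ((j : ℤ) : ℝ))) *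
        MeasureTheory.eLpNorm (lpOp ψ j f) 2 (MeasureTheory.volume.restrict I.toSet) ^ 2)
    ^ (1 / 2 : ℝ)

/-- The square integrable functions in `Q_α(ℝⁿ)`. -/
def qSpaceL2 (n : ℕ) (α : ℝ) : Set (E n → ℂ) :=
  {f | MeasureTheory.MemLp f 2 MeasureTheory.volume ∧ qNorm α f < ∞}

/-- The square integrable functions in `𝓛^{2, n-2α, α}`. -/
def lpSpaceL2 {n : ℕ} (ψ : 𝓢(E n, ℂ)) (α : ℝ) : Set (E n → ℂ) :=
  {f | MeasureTheory.MemLp f 2 MeasureTheory.volume ∧ lpNorm ψ α f < ∞}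

end QSpace

namespace QSpace

open MeasureTheory

/-! The squared norms `qSq` and `lpSq` are compared with kernels that decay polynomially at scale
2^(-j). Such a kernel is cut into dyadic balls, so that each piece becomes an integral over an
enlarged cube, to which the supremum applies. Enlarging a cube by 2^k costs at most a multiple of
2^(nk), and the decay absorbs this.

Littlewood-Paley norm by Q norm: ψ has mean zero, so Δ_j f(x) = ∫ ψ_j(t)(f(x-t)-f(x)) dt, and
Cauchy-Schwarz puts |f(x-t)-f(x)|² against a decaying kernel. Summed with weights 2^(2αj) over 2^j l
≥ 1, these kernels are bounded by |t|^(-2α-n) with a tail of order (1+|t|/l)^(-M)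
(`tsum_decayKernel_le`). This is the Q integrand with rapidly decaying tails; it remains to
integrate over the cube.

Q norm by Littlewood-Paley norm: L² convergence of ∑ Δ_j f gives |f(x)-f(y)| ≤ ∑ |Δ_j f(x)-Δ_j f(y)|
off a null set. If φ is Schwartz with Fourier transform 1 on |ξ| ≤ 2, then Δ_j f = φ_j * Δ_j f, so
each term is at most a constant times min(1, 2^j|x-y|) times the averages `lpAvg` of |Δ_j f| at x
and y. Writing min(1,s) = s^α min(s^(-α), s^(1-α)) and using Cauchy-Schwarz in j with the last
factor as weight (summable over dyadic s because 0 < α < 1) leaves a kernel in x-y whose integral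
over the cube is at most a multiple of min(1, (2^j l)^(1-α)). For 2^j l ≥ 1 the averages are
controlled through enlarged cubes (`exists_tsum_lintegral_lpAvg_sq_le`). Frequencies with 2^j l < 1
do not occur in the sum attached to the cube; there, cubes of side comparable to 2^(-j) or larger
give a uniform pointwise bound on `lpAvg` (`exists_lpAvg_sq_le_lpSq`), and the powers of 2^j l make
the sum converge. -/

/-! ### Weighted Cauchy-Schwarz and scale-invariant dyadic sums -/

/-- Cauchy-Schwarz with a weight. -/
theorem sq_lintegral_mul_le {X : Type*} [MeasurableSpace X] {μ : Measure X} {k g : X → ℝ≥0∞}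
    (hk : AEMeasurable k μ) (hg : AEMeasurable g μ) :
    (∫⁻ x, k x * g x ∂μ) ^ 2 ≤ (∫⁻ x, k x ∂μ) * ∫⁻ x, k x * g x ^ 2 ∂μ := by
  have hsq : ∀ a : ℝ≥0∞, (a ^ (1 / 2 : ℝ)) ^ (2 : ℝ) = a := fun a => by
    rw [← ENNReal.rpow_mul]; norm_num
  have hs : ∀ a : ℝ≥0∞, a ^ (1 / 2 : ℝ) * a ^ (1 / 2 : ℝ) = a := fun a => by
    rw [← ENNReal.rpow_add_of_nonneg _ _ (by norm_num) (by norm_num)]; norm_num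
  have hk2 : AEMeasurable (fun x => k x ^ (1 / 2 : ℝ)) μ := hk.pow_const _
  have h := ENNReal.lintegral_mul_le_Lp_mul_Lq μ
    (p := 2) (q := 2) Real.HolderConjugate.two_two
    (f := fun x => k x ^ (1 / 2 : ℝ)) (g := fun x => k x ^ (1 / 2 : ℝ) * g x) hk2 (hk2.mul hg)
  have e1 : ∀ x, ((fun x => k x ^ (1 / 2 : ℝ)) * fun x => k x ^ (1 / 2 : ℝ) * g x) x
      = k x * g x := fun x => by
    simp only [Pi.mul_apply]; rw [← mul_assoc, hs]
  have e2 : ∀ x, (k x ^ (1 / 2 : ℝ) * g x) ^ (2 : ℝ) = k x * g x ^ 2 := fun x => by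
    rw [ENNReal.mul_rpow_of_nonneg _ _ (by norm_num), hsq, ENNReal.rpow_two]
  simp only [e1, e2, hsq] at h
  calc _ ≤ ((∫⁻ x, k x ∂μ) ^ (1 / 2 : ℝ) * (∫⁻ x, k x * g x ^ 2 ∂μ) ^ (1 / 2 : ℝ)) ^ 2 := by
        gcongr
    _ = _ := by rw [mul_pow, ← ENNReal.rpow_two, hsq, ← ENNReal.rpow_two, hsq]

theorem sq_tsum_mul_le {ι : Type*} (k g : ι → ℝ≥0∞) :
    (∑' i, k i * g i) ^ 2 ≤ (∑' i, k i) * ∑' i, k i * g i ^ 2 := by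
  let _ : MeasurableSpace ι := ⊤
  have _ : MeasurableSingletonClass ι := ⟨fun _ => trivial⟩
  simpa only [lintegral_count] using sq_lintegral_mul_le (μ := Measure.count) (k := k) (g := g)
    measurable_from_top.aemeasurable measurable_from_top.aemeasurable

/-- Polynomial decay is dominated by a sum of multiples of indicators of dyadic balls. -/
theorem ofReal_one_add_rpow_neg_le {N t : ℝ} (hN : 0 ≤ N) (ht : 0 ≤ t) :
    ENNReal.ofReal ((1 + t) ^ (-N)) ≤ ENNReal.ofReal (2 ^ N) *
      ∑' k : ℕ, if t ≤ (2 : ℝ) ^ k then ENNReal.ofReal ((2 : ℝ) ^ (-N * k)) else 0 := by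
  obtain ⟨k, h1, h2⟩ : ∃ k : ℕ, t ≤ (2 : ℝ) ^ k ∧ (2 : ℝ) ^ k ≤ 2 * (1 + t) := by
    obtain ⟨k, h1, h2⟩ := exists_nat_pow_near (x := 1 + t) (y := 2) (by linarith) (by norm_num)
    exact ⟨k + 1, by linarith, by rw [pow_succ]; linarith⟩
  calc _ ≤ ENNReal.ofReal (2 ^ N) * ENNReal.ofReal ((2 : ℝ) ^ (-N * k)) := by
        rw [← ENNReal.ofReal_mul (by positivity)]
        apply ENNReal.ofReal_le_ofReal
        rw [mul_comm (-N), Real.rpow_mul (by norm_num), Real.rpow_natCast,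
          Real.rpow_neg (by positivity), Real.rpow_neg (by positivity), ← div_eq_mul_inv,
          ← Real.div_rpow (by norm_num) (by positivity), ← Real.inv_rpow (by positivity)]
        apply Real.rpow_le_rpow (by positivity) _ hN
        rw [inv_eq_one_div, div_le_div_iff₀ (by positivity) (by positivity)]
        linarith
    _ ≤ _ := by
        gcongr
        refine le_trans ?_ (ENNReal.le_tsum k)
        rw [if_pos h1]

theorem summable_min_rpow {a b : ℝ} (ha : 0 < a) (hb : 0 < b) :
    Summable fun j : ℤ => min ((2 : ℝ) ^ (-a * j)) ((2 : ℝ) ^ (b * j)) := by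
  have h0 : ∀ j : ℤ, 0 ≤ min ((2 : ℝ) ^ (-a * j)) ((2 : ℝ) ^ (b * j)) := fun j => by positivity
  have hg : ∀ c : ℝ, 0 < c → Summable fun k : ℕ => ((2 : ℝ) ^ (-c)) ^ k := fun c hc =>
    summable_geometric_of_lt_one (by positivity)
      (Real.rpow_lt_one_of_one_lt_of_neg (by norm_num) (by linarith))
  rw [summable_int_iff_summable_nat_and_neg]
  constructor
  · refine Summable.of_nonneg_of_le (fun k => h0 _) (fun k => ?_) (hg a ha)
    refine (min_le_left _ _).trans (le_of_eq ?_)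
    rw [Real.rpow_mul (by norm_num)]; simp
  · refine Summable.of_nonneg_of_le (fun k => h0 _) (fun k => ?_) (hg b hb)
    refine (min_le_right _ _).trans (le_of_eq ?_)
    rw [← Real.rpow_natCast, ← Real.rpow_mul (by norm_num)]; push_cast; ring_nf

/-- The terms decay geometrically on both sides of the scale 2^j ≈ 1/t, so t only shifts the sum.
This uniformity in t is what every later sum over frequencies relies on. -/
theorem tsum_min_rpow_le {a b : ℝ} (ha : 0 < a) (hb : 0 < b) :
    ∃ C : ℝ≥0, ∀ t : ℝ, 0 < t →
      ∑' j : ℤ, ENNReal.ofReal (min (((2 : ℝ) ^ j * t) ^ (-a)) (((2 : ℝ) ^ j * t) ^ b)) ≤ C := by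
  have hs := (summable_min_rpow ha hb).mul_left ((2 : ℝ) ^ b)
  refine ⟨Real.toNNReal (∑' j : ℤ, (2 : ℝ) ^ b *
    min ((2 : ℝ) ^ (-a * j)) ((2 : ℝ) ^ (b * j))), fun t ht => ?_⟩
  obtain ⟨m, hm1, hm2⟩ := exists_mem_Ico_zpow ht (one_lt_two : (1 : ℝ) < 2)
  rw [← ENNReal.ofReal, ENNReal.ofReal_tsum_of_nonneg (fun j => by positivity) hs,
    ← (Equiv.subRight m).tsum_eq]
  refine ENNReal.tsum_le_tsum fun j => ENNReal.ofReal_le_ofReal ?_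
  -- After the index shift by m only s ∈ [1, 2] remains of t, and it costs at most the factor 2^b.
  set s := (2 : ℝ) ^ (-m) * t with hs
  have hs1 : 1 ≤ s := by
    rw [hs, zpow_neg, inv_mul_eq_div, le_div_iff₀ (by positivity)]; linarith
  have hs2 : s ≤ 2 := by
    rw [hs, zpow_neg, inv_mul_eq_div, div_le_iff₀ (by positivity)]
    rw [zpow_add_one₀ (by norm_num)] at hm2; linarith
  have he : (2 : ℝ) ^ ((Equiv.subRight m) j) * t = (2 : ℝ) ^ (j : ℝ) * s := by
    rw [Real.rpow_intCast, hs, Equiv.subRight_apply, zpow_sub₀ (by norm_num), zpow_neg]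
    field_simp
  have hb1 : 1 ≤ (2 : ℝ) ^ b := Real.one_le_rpow (by norm_num) hb.le
  clear_value s
  rw [he, Real.mul_rpow (by positivity) (by positivity),
    Real.mul_rpow (by positivity) (by positivity), ← Real.rpow_mul (by norm_num),
    ← Real.rpow_mul (by norm_num), mul_min_of_nonneg _ _ (by positivity)]
  refine min_le_min ?_ ?_
  · rw [show (j : ℝ) * -a = -a * j by ring, mul_comm]
    gcongr
    exact (Real.rpow_le_one_of_one_le_of_nonpos hs1 (by linarith)).trans hb1
  · rw [show (j : ℝ) * b = b * j by ring, mul_comm]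
    gcongr

theorem tsum_geometric_ofReal_lt_top {c : ℝ} (hc : 0 < c) :
    ∑' k : ℕ, ENNReal.ofReal ((2 : ℝ) ^ (-c * k)) < ∞ := by
  have : ∀ k : ℕ, ENNReal.ofReal ((2 : ℝ) ^ (-c * k)) = ENNReal.ofReal ((2 : ℝ) ^ (-c)) ^ k := by
    intro k
    rw [Real.rpow_mul (by norm_num), Real.rpow_natCast, ENNReal.ofReal_pow (by positivity)]
  simp_rw [this, ENNReal.tsum_geometric]
  rw [ENNReal.inv_lt_top, tsub_pos_iff_lt, ENNReal.ofReal_lt_one]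
  exact Real.rpow_lt_one_of_one_lt_of_neg (by norm_num) (by linarith)

/-- The volume of a ball is a dimensional constant times `r ^ n`. -/
theorem volume_closedBall_le (n : ℕ) : ∃ C : ℝ≥0, ∀ (x : E n) (r : ℝ), 0 ≤ r →
    volume (Metric.closedBall x r) ≤ C * ENNReal.ofReal (r ^ n) := by
  refine ⟨(volume (Metric.ball (0 : E n) 1)).toNNReal, fun x r hr => ?_⟩
  rw [Measure.addHaar_closedBall _ _ hr, ENNReal.coe_toNNReal measure_ball_lt_top.ne, mul_comm]
  simp

/-- The measure ‖h‖^(-n) dh gives all dyadic annuli 2^k ≤ ‖h‖ < 2^(k+1) comparable mass, so the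
integral is dominated by the dyadic sum of `tsum_min_rpow_le`. The factor 2^b pays for replacing ‖h‖
by 2^k. -/
theorem lintegral_norm_rpow_neg_mul_min_le {n : ℕ} (hn : 1 ≤ n) {a b : ℝ} (ha : 0 < a)
    (hb : 0 < b) : ∃ C : ℝ≥0, ∀ t : ℝ, 0 < t → ∫⁻ h : E n, ENNReal.ofReal (‖h‖ ^ (-(n : ℝ)) *
      min ((t * ‖h‖) ^ (-a)) ((t * ‖h‖) ^ b)) ≤ C := by
  obtain ⟨C₁, h₁⟩ := tsum_min_rpow_le ha hb
  obtain ⟨C₂, h₂⟩ := volume_closedBall_le n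
  refine ⟨C₂ * Real.toNNReal (2 ^ n * 2 ^ b) * C₁, fun t ht => ?_⟩
  set c : ℤ → ℝ := fun k => ((2 : ℝ) ^ k) ^ (-(n : ℝ)) *
    (2 ^ b * min (((2 : ℝ) ^ k * t) ^ (-a)) (((2 : ℝ) ^ k * t) ^ b)) with hc
  have hpt : ∀ h : E n, ENNReal.ofReal (‖h‖ ^ (-(n : ℝ)) *
      min ((t * ‖h‖) ^ (-a)) ((t * ‖h‖) ^ b)) ≤
      ∑' k : ℤ, (Metric.closedBall (0 : E n) (2 ^ (k + 1))).indicator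
        (fun _ => ENNReal.ofReal (c k)) h := by
    intro h
    rcases eq_or_ne h 0 with rfl | hh
    -- The convention 0^p = 0 for p ≠ 0 makes the integrand vanish at the origin; this needs n ≥ 1.
    · have : (0 : ℝ) ^ (-(n : ℝ)) = 0 := Real.zero_rpow (by simp; omega)
      simp [this]
    obtain ⟨k, hk1, hk2⟩ := exists_mem_Ico_zpow (norm_pos_iff.2 hh) (one_lt_two : (1 : ℝ) < 2)
    refine le_trans ?_ (ENNReal.le_tsum k)
    rw [Set.indicator_of_mem (by simpa using hk2.le)]
    apply ENNReal.ofReal_le_ofReal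
    have hb1 : 1 ≤ (2 : ℝ) ^ b := Real.one_le_rpow (by norm_num) hb.le
    have hk0 : 0 < (2 : ℝ) ^ k := by positivity
    rw [hc]
    refine mul_le_mul (Real.rpow_le_rpow_of_nonpos hk0 hk1 (by simp)) ?_
      (by positivity) (by positivity)
    rw [mul_min_of_nonneg _ _ (by positivity)]
    refine min_le_min ?_ ?_
    · refine le_trans (Real.rpow_le_rpow_of_nonpos (x := 2 ^ k * t) (by positivity) ?_
        (by linarith)) (le_mul_of_one_le_left (by positivity) hb1)
      rw [mul_comm]; gcongr
    · rw [← Real.mul_rpow (by positivity) (by positivity)]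
      refine Real.rpow_le_rpow (by positivity) ?_ hb.le
      rw [zpow_add_one₀ (by norm_num)] at hk2
      nlinarith
  calc _ ≤ ∫⁻ h : E n, ∑' k : ℤ, (Metric.closedBall (0 : E n) (2 ^ (k + 1))).indicator
        (fun _ => ENNReal.ofReal (c k)) h := lintegral_mono hpt
    _ = ∑' k : ℤ, ENNReal.ofReal (c k) * volume (Metric.closedBall (0 : E n) (2 ^ (k + 1))) := by
        rw [lintegral_tsum fun k =>
          (measurable_const.indicator Metric.isClosed_closedBall.measurableSet).aemeasurable]
        refine tsum_congr fun k => ?_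
        rw [lintegral_indicator_const Metric.isClosed_closedBall.measurableSet]
    _ ≤ ∑' k : ℤ, (C₂ * Real.toNNReal (2 ^ n * 2 ^ b) : ℝ≥0) * ENNReal.ofReal
        (min (((2 : ℝ) ^ k * t) ^ (-a)) (((2 : ℝ) ^ k * t) ^ b)) := by
        refine ENNReal.tsum_le_tsum fun k => ?_
        refine (mul_le_mul_right (h₂ 0 _ (by positivity)) _).trans (le_of_eq ?_)
        rw [mul_left_comm, ENNReal.coe_mul, mul_assoc, ← ENNReal.ofReal_mul (by positivity),
          ← ENNReal.ofReal.eq_1, ← ENNReal.ofReal_mul (by positivity)]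
        congr 2
        have hk0 : 0 < (2 : ℝ) ^ k := by positivity
        rw [hc]
        simp only
        rw [zpow_add_one₀ (by norm_num), mul_pow, Real.rpow_neg hk0.le, Real.rpow_natCast]
        field_simp
    _ ≤ _ := by
        rw [ENNReal.tsum_mul_left, ENNReal.coe_mul (C₂ * _) C₁]
        gcongr
        exact h₁ t ht

/-! ### Geometry of cubes -/

variable {n : ℕ}

theorem Cube.toSet_eq_preimage (I : Cube n) : I.toSet = (fun x : E n => (WithLp.ofLp x)) ⁻¹'
    Set.Icc (fun i => I.corner i) (fun i => I.corner i + I.side) := by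
  ext x
  simp [Cube.toSet, Pi.le_def, forall_and]

theorem Cube.measurableSet_toSet (I : Cube n) : MeasurableSet I.toSet := by
  rw [I.toSet_eq_preimage]
  exact (PiLp.volume_preserving_ofLp (Fin n)).measurable measurableSet_Icc

theorem Cube.volume_toSet (I : Cube n) : volume I.toSet = ENNReal.ofReal (I.side ^ n) := by
  rw [I.toSet_eq_preimage, (PiLp.volume_preserving_ofLp (Fin n)).measure_preimage
    measurableSet_Icc.nullMeasurableSet, Real.volume_Icc_pi]
  simp [ENNReal.ofReal_pow I.side_pos.le]

/-- The cube obtained by moving each face of `I` outwards by `r`. -/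
def Cube.expand (I : Cube n) (r : ℝ) (hr : 0 ≤ r) : Cube n where
  corner := WithLp.toLp 2 fun i => I.corner i - r
  side := I.side + 2 * r
  side_pos := by have := I.side_pos; linarith

/-- The cube with center `x` and edge length `2 * r`. -/
def Cube.centered (x : E n) (r : ℝ) (hr : 0 < r) : Cube n where
  corner := WithLp.toLp 2 fun i => x i - r
  side := 2 * r
  side_pos := by linarith

theorem abs_coord_le_norm (x : E n) (i : Fin n) : |x i| ≤ ‖x‖ := PiLp.norm_apply_le x i

theorem Cube.mem_expand {I : Cube n} {r : ℝ} (hr : 0 ≤ r) {x y : E n} (hx : x ∈ I.toSet)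
    (hxy : ‖x - y‖ ≤ r) : y ∈ (I.expand r hr).toSet := by
  intro i
  have h1 := abs_le.1 ((abs_coord_le_norm (x - y) i).trans hxy)
  have h2 := hx i
  simp only [PiLp.sub_apply] at h1
  simp only [Cube.expand]
  constructor <;> linarith

theorem Cube.subset_expand {I : Cube n} {r : ℝ} (hr : 0 ≤ r) :
    I.toSet ⊆ (I.expand r hr).toSet :=
  fun x hx => Cube.mem_expand hr hx (by simpa using hr)

theorem Cube.closedBall_subset_centered (x : E n) (r : ℝ) (hr : 0 < r) :
    Metric.closedBall x r ⊆ (Cube.centered x r hr).toSet := by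
  intro y hy i
  rw [mem_closedBall_iff_norm] at hy
  have h1 := abs_le.1 ((abs_coord_le_norm (y - x) i).trans hy)
  simp only [PiLp.sub_apply] at h1
  simp only [Cube.centered]
  constructor <;> linarith

theorem Cube.norm_sub_le {I : Cube n} {x y : E n} (hx : x ∈ I.toSet) (hy : y ∈ I.toSet) :
    ‖x - y‖ ≤ n * I.side := by
  have hc : ∀ i, ‖(x - y) i‖ ≤ I.side := fun i => by
    rw [PiLp.sub_apply, Real.norm_eq_abs, abs_le]
    have h1 := hx i
    have h2 := hy i
    constructor <;> linarith
  have hs := I.side_pos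
  rw [EuclideanSpace.norm_eq]
  refine Real.sqrt_le_iff.2 ⟨by positivity, ?_⟩
  calc ∑ i, ‖(x - y) i‖ ^ 2 ≤ ∑ _i : Fin n, I.side ^ 2 :=
        Finset.sum_le_sum fun i _ => pow_le_pow_left₀ (norm_nonneg _) (hc i) 2
    _ = n * I.side ^ 2 := by simp
    _ ≤ (n : ℝ) ^ 2 * I.side ^ 2 := by
        gcongr
        rcases Nat.eq_zero_or_pos n with h | h
        · simp [h]
        · exact le_self_pow₀ (by exact_mod_cast h) (by norm_num)
    _ = (n * I.side) ^ 2 := by ring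

/-- Dividing out a scale larger than one costs at most the `n`-th power of that scale. -/
theorem mul_rpow_sub_le {l s α : ℝ} (hl : 0 < l) (hs : 1 ≤ s) (hα : 0 < α) :
    (l * s) ^ ((n : ℝ) - 2 * α) ≤ l ^ ((n : ℝ) - 2 * α) * s ^ n := by
  rw [Real.mul_rpow hl.le (by linarith)]
  gcongr
  rw [← Real.rpow_natCast]
  exact Real.rpow_le_rpow_of_exponent_le hs (by linarith)

/-! ### Decaying kernels and Schwartz functions -/

/-- The `L¹`-normalized dilate of the weight `(1 + ‖x‖) ^ (-N)`. -/
noncomputable def decayKernel (N l : ℝ) (x : E n) : ℝ≥0∞ :=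
  ENNReal.ofReal (l ^ n * (1 + l * ‖x‖) ^ (-N))

theorem continuous_decayKernel {N l : ℝ} (hl : 0 ≤ l) :
    Continuous (decayKernel N l : E n → ℝ≥0∞) := by
  refine ENNReal.continuous_ofReal.comp (continuous_const.mul ?_)
  refine Continuous.rpow_const (by fun_prop) fun x => Or.inl ?_
  positivity

theorem measurable_decayKernel {N l : ℝ} (hl : 0 ≤ l) :
    Measurable (decayKernel N l : E n → ℝ≥0∞) := (continuous_decayKernel hl).measurable

/-- Turns integrals against the kernel into integrals over balls, hence over cubes, which is the
only form in which the two norms give information. -/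
theorem decayKernel_le {N l : ℝ} (hN : 0 ≤ N) (hl : 0 < l) (x : E n) :
    decayKernel N l x ≤ ∑' k : ℕ, ENNReal.ofReal (2 ^ N) * ENNReal.ofReal ((2 : ℝ) ^ (-N * k)) *
      ENNReal.ofReal (l ^ n) * (Metric.closedBall (0 : E n) (2 ^ k / l)).indicator 1 x := by
  rw [decayKernel, ENNReal.ofReal_mul (by positivity)]
  refine (mul_le_mul_right (ofReal_one_add_rpow_neg_le hN
    (by positivity : 0 ≤ l * ‖x‖)) _).trans (le_of_eq ?_)
  rw [← ENNReal.tsum_mul_left, ← ENNReal.tsum_mul_left]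
  refine tsum_congr fun k => ?_
  by_cases h : l * ‖x‖ ≤ 2 ^ k
  · have : x ∈ Metric.closedBall (0 : E n) (2 ^ k / l) := by
      rw [mem_closedBall_zero_iff, le_div_iff₀ hl]; linarith
    rw [if_pos h, Set.indicator_of_mem this, Pi.one_apply]
    ring
  · have : x ∉ Metric.closedBall (0 : E n) (2 ^ k / l) := by
      rw [mem_closedBall_zero_iff, le_div_iff₀ hl]; linarith
    rw [if_neg h, Set.indicator_of_notMem this]
    simp

theorem ofReal_pow_mul_volume_closedBall_le (n : ℕ) : ∃ C : ℝ≥0, ∀ (x : E n) (k : ℕ) (l : ℝ),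
    0 < l → ENNReal.ofReal (l ^ n) * volume (Metric.closedBall x (2 ^ k / l)) ≤
      C * ENNReal.ofReal (2 ^ ((n : ℝ) * k)) := by
  obtain ⟨C, hC⟩ := volume_closedBall_le n
  refine ⟨C, fun x k l hl => ?_⟩
  refine (mul_le_mul_right (hC x _ (by positivity)) _).trans (le_of_eq ?_)
  rw [mul_left_comm, ← ENNReal.ofReal_mul (by positivity)]
  congr 2
  rw [mul_comm (n : ℝ), Real.rpow_mul (by norm_num), Real.rpow_natCast, Real.rpow_natCast,
    ← mul_pow, mul_div_cancel₀ _ hl.ne']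

theorem ofReal_two_rpow_mul (a b : ℝ) : ENNReal.ofReal ((2 : ℝ) ^ a) * ENNReal.ofReal (2 ^ b) =
    ENNReal.ofReal (2 ^ (a + b)) := by
  rw [← ENNReal.ofReal_mul (by positivity), ← Real.rpow_add (by norm_num)]

/-- The k-th ball contributes 2^(-Nk) 2^(nk), a geometric series for N > n; the normalization
cancels l. -/
theorem lintegral_decayKernel_le {N : ℝ} (hN : n < N) : ∃ C : ℝ≥0, ∀ l : ℝ, 0 < l →
    ∫⁻ x : E n, decayKernel N l x ≤ C := by
  obtain ⟨C, hC⟩ := ofReal_pow_mul_volume_closedBall_le n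
  have hN0 : 0 ≤ N := (Nat.cast_nonneg n).trans hN.le
  have hfin : ENNReal.ofReal (2 ^ N) * C * ∑' k : ℕ, ENNReal.ofReal ((2 : ℝ) ^ (-(N - n) * k))
      < ∞ := ENNReal.mul_lt_top (ENNReal.mul_lt_top ENNReal.ofReal_lt_top ENNReal.coe_lt_top)
        (tsum_geometric_ofReal_lt_top (sub_pos.2 hN))
  refine ⟨(ENNReal.ofReal (2 ^ N) * C *
    ∑' k : ℕ, ENNReal.ofReal ((2 : ℝ) ^ (-(N - n) * k))).toNNReal, fun l hl => ?_⟩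
  rw [ENNReal.coe_toNNReal hfin.ne]
  have hm : ∀ k : ℕ, MeasurableSet (Metric.closedBall (0 : E n) (2 ^ k / l)) := fun k =>
    Metric.isClosed_closedBall.measurableSet
  refine (lintegral_mono (decayKernel_le hN0 hl)).trans ?_
  rw [lintegral_tsum fun k => ((measurable_one.indicator (hm k)).const_mul _).aemeasurable,
    ← ENNReal.tsum_mul_left]
  refine ENNReal.tsum_le_tsum fun k => ?_
  rw [lintegral_const_mul _ (measurable_one.indicator (hm k)), lintegral_indicator_one (hm k),
    mul_assoc]
  refine (mul_le_mul_right (hC 0 k l hl) _).trans (le_of_eq ?_)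
  rw [show -(N - n) * (k : ℝ) = -N * k + n * k by ring, ← ofReal_two_rpow_mul]
  ring

theorem exists_norm_le_one_add_rpow {F : Type*} [NormedAddCommGroup F] [NormedSpace ℝ F]
    (ψ : 𝓢(E n, F)) (N : ℝ) : ∃ C : ℝ, 0 ≤ C ∧ ∀ x, ‖ψ x‖ ≤ C * (1 + ‖x‖) ^ (-N) := by
  obtain ⟨k, hk⟩ := exists_nat_ge N
  refine ⟨2 ^ k * ((Finset.Iic (k, 0)).sup fun m : ℕ × ℕ => SchwartzMap.seminorm ℝ m.1 m.2) ψ,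
    by positivity, fun x => ?_⟩
  have h := SchwartzMap.one_add_le_sup_seminorm_apply (𝕜 := ℝ) (m := (k, 0)) le_rfl le_rfl ψ x
  rw [norm_iteratedFDeriv_zero] at h
  have h1 : (1 + ‖x‖) ^ N ≤ (1 + ‖x‖) ^ k := by
    rw [← Real.rpow_natCast]
    exact Real.rpow_le_rpow_of_exponent_le (by linarith [norm_nonneg x]) hk
  rw [Real.rpow_neg (by positivity), ← div_eq_mul_inv, le_div_iff₀ (by positivity), mul_comm]
  exact (mul_le_mul_of_nonneg_right h1 (norm_nonneg _)).trans h

/-- Points at distance at least 1 are handled by the triangle inequality. Otherwise the mean value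
inequality applies on the unit ball about v, where the decay of the derivative is comparable to its
decay at v. -/
theorem exists_norm_sub_le_min_mul (φ : 𝓢(E n, ℂ)) {N : ℝ} (hN : 0 ≤ N) :
    ∃ C : ℝ, 0 ≤ C ∧ ∀ u v, ‖φ u - φ v‖ ≤
      C * (min 1 ‖u - v‖ * ((1 + ‖u‖) ^ (-N) + (1 + ‖v‖) ^ (-N))) := by
  obtain ⟨C₁, hC₁, h₁⟩ := exists_norm_le_one_add_rpow φ N
  obtain ⟨C₂, hC₂, h₂⟩ := exists_norm_le_one_add_rpow (SchwartzMap.fderivCLM ℝ (E n) ℂ φ) N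
  refine ⟨C₁ + C₂ * 2 ^ N, by positivity, fun u v => ?_⟩
  rcases le_total 1 ‖u - v‖ with h | h
  · rw [min_eq_left h, one_mul]
    have e1 := h₁ u
    have e2 := h₁ v
    have e3 := norm_sub_le (φ u) (φ v)
    have : 0 ≤ C₂ * 2 ^ N * ((1 + ‖u‖) ^ (-N) + (1 + ‖v‖) ^ (-N)) := by positivity
    linarith
  · rw [min_eq_right h]
    have key : ‖φ u - φ v‖ ≤ C₂ * (2 ^ N * (1 + ‖v‖) ^ (-N)) * ‖u - v‖ := by
      refine Convex.norm_image_sub_le_of_norm_fderiv_le (𝕜 := ℝ) (s := Metric.closedBall v 1)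
        (fun x _ => φ.differentiableAt) (fun x hx => ?_) (convex_closedBall _ _) (by simp)
        (by simpa [dist_eq_norm] using h)
      rw [← SchwartzMap.fderivCLM_apply ℝ]
      refine (h₂ x).trans ?_
      gcongr
      rw [mem_closedBall_iff_norm] at hx
      have hv : 1 + ‖v‖ ≤ 2 * (1 + ‖x‖) := by
        have := norm_sub_norm_le v x
        rw [norm_sub_rev] at this
        linarith [norm_nonneg x]
      have : (2 : ℝ) ^ N * (1 + ‖v‖) ^ (-N) = ((1 + ‖v‖) / 2) ^ (-N) := by
        rw [Real.div_rpow (by positivity) (by norm_num), Real.rpow_neg (by norm_num : (0:ℝ) ≤ 2)]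
        field_simp
      rw [this]
      exact Real.rpow_le_rpow_of_nonpos (by positivity) (by linarith) (by linarith)
    refine key.trans ?_
    rw [show C₂ * (2 ^ N * (1 + ‖v‖) ^ (-N)) * ‖u - v‖ =
      C₂ * 2 ^ N * (‖u - v‖ * (1 + ‖v‖) ^ (-N)) by ring]
    have h0 : 0 ≤ (1 + ‖u‖) ^ (-N) := by positivity
    gcongr <;> linarith

/-- The dilate `2^(jn) ψ(2^j x)` as a Schwartz function. -/
noncomputable def dilateS (ψ : 𝓢(E n, ℂ)) (j : ℤ) : 𝓢(E n, ℂ) :=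
  (2 : ℂ) ^ (j * (n : ℤ)) • SchwartzMap.compCLMOfContinuousLinearEquiv ℂ
    (ContinuousLinearEquiv.smulLeft (Units.mk0 ((2 : ℝ) ^ j) (by positivity))) ψ

theorem coe_dilateS (ψ : 𝓢(E n, ℂ)) (j : ℤ) : (dilateS ψ j : E n → ℂ) = dilate ψ j := by
  ext x
  simp [dilateS, dilate, Units.smul_def]

theorem norm_two_zpow_mul (j : ℤ) : ‖(2 : ℂ) ^ (j * (n : ℤ))‖ = ((2 : ℝ) ^ j) ^ n := by
  rw [norm_zpow, zpow_mul]; simp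

theorem exists_enorm_dilate_le (ψ : 𝓢(E n, ℂ)) (N : ℝ) : ∃ C : ℝ≥0, ∀ (j : ℤ) (x : E n),
    ‖dilate ψ j x‖ₑ ≤ C * decayKernel N (2 ^ j) x := by
  obtain ⟨C, hC, h⟩ := exists_norm_le_one_add_rpow ψ N
  refine ⟨C.toNNReal, fun j x => ?_⟩
  rw [decayKernel, ← ENNReal.ofReal.eq_1, ← ENNReal.ofReal_mul hC, ← ofReal_norm]
  apply ENNReal.ofReal_le_ofReal
  rw [dilate, norm_mul, norm_two_zpow_mul, mul_left_comm]
  gcongr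
  have := h ((2 : ℝ) ^ j • x)
  rwa [norm_smul, Real.norm_of_nonneg (by positivity)] at this

theorem exists_enorm_dilate_sub_le (φ : 𝓢(E n, ℂ)) {N : ℝ} (hN : 0 ≤ N) :
    ∃ C : ℝ≥0, ∀ (j : ℤ) (x y : E n), ‖dilate φ j x - dilate φ j y‖ₑ ≤
      C * ENNReal.ofReal (min 1 (2 ^ j * ‖x - y‖)) *
        (decayKernel N (2 ^ j) x + decayKernel N (2 ^ j) y) := by
  obtain ⟨C, hC, h⟩ := exists_norm_sub_le_min_mul φ hN
  refine ⟨C.toNNReal, fun j x y => ?_⟩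
  rw [decayKernel, decayKernel, ← ENNReal.ofReal_add (by positivity) (by positivity),
    ← ENNReal.ofReal.eq_1, ← ENNReal.ofReal_mul hC, ← ENNReal.ofReal_mul (by positivity),
    ← ofReal_norm]
  apply ENNReal.ofReal_le_ofReal
  rw [dilate, dilate, ← mul_sub, norm_mul, norm_two_zpow_mul]
  have := h ((2 : ℝ) ^ j • x) ((2 : ℝ) ^ j • y)
  rw [← smul_sub, norm_smul, norm_smul, norm_smul, Real.norm_of_nonneg (by positivity)] at this
  calc _ ≤ ((2 : ℝ) ^ j) ^ n * _ := mul_le_mul_of_nonneg_left this (by positivity)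
    _ = _ := by ring

/-! ### The operators Δ_j on L² and the reproducing formula -/

theorem eLpNorm_two_sq {X : Type*} [MeasurableSpace X] (μ : Measure X) (f : X → ℂ) :
    eLpNorm f 2 μ ^ 2 = ∫⁻ x, ‖f x‖ₑ ^ 2 ∂μ := by
  have := eLpNorm_nnreal_pow_eq_lintegral (μ := μ) (f := f) (p := 2) (by norm_num)
  simpa using this

theorem continuous_dilate (ψ : 𝓢(E n, ℂ)) (j : ℤ) : Continuous (dilate ψ j) := by
  rw [← coe_dilateS]; exact (dilateS ψ j).continuous

theorem integrable_dilate (ψ : 𝓢(E n, ℂ)) (j : ℤ) : Integrable (dilate ψ j) := by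
  rw [← coe_dilateS]; exact (dilateS ψ j).integrable

theorem memLp_two_dilate (ψ : 𝓢(E n, ℂ)) (j : ℤ) : MemLp (dilate ψ j) 2 := by
  rw [← coe_dilateS]; exact (dilateS ψ j).memLp 2

theorem lpOp_apply (ψ : 𝓢(E n, ℂ)) (j : ℤ) (f : E n → ℂ) (x : E n) :
    lpOp ψ j f x = ∫ t, dilate ψ j t * f (x - t) := rfl

theorem lpOp_apply_swap (ψ : 𝓢(E n, ℂ)) (j : ℤ) (f : E n → ℂ) (x : E n) :
    lpOp ψ j f x = ∫ t, dilate ψ j (x - t) * f t := convolution_eq_swap _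

theorem lpOp_congr_ae (ψ : 𝓢(E n, ℂ)) (j : ℤ) {f g : E n → ℂ} (h : f =ᵐ[volume] g) :
    lpOp ψ j f = lpOp ψ j g := convolution_congr _ (Filter.EventuallyEq.refl _ _) h

theorem measurable_lpOp (ψ : 𝓢(E n, ℂ)) (j : ℤ) {f : E n → ℂ} (hf : Measurable f) :
    Measurable (lpOp ψ j f) := by
  refine (StronglyMeasurable.integral_prod_right (ν := volume)
    (f := fun x t => dilate ψ j t * f (x - t)) ?_).measurable
  refine Measurable.stronglyMeasurable ?_
  exact ((continuous_dilate ψ j).measurable.comp measurable_snd).mul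
    (hf.comp (measurable_fst.sub measurable_snd))

theorem MemLp.comp_sub_left {f : E n → ℂ} (hf : MemLp f 2) (x : E n) :
    MemLp (fun t => f (x - t)) 2 :=
  hf.comp_measurePreserving (Measure.measurePreserving_sub_left volume x)

theorem integrable_dilate_mul (ψ : 𝓢(E n, ℂ)) (j : ℤ) {f : E n → ℂ} (hf : MemLp f 2) (x : E n) :
    Integrable fun t => dilate ψ j t * f (x - t) :=
  (memLp_two_dilate ψ j).integrable_mul (MemLp.comp_sub_left hf x)

theorem lpOp_sub (ψ : 𝓢(E n, ℂ)) (j : ℤ) {f g : E n → ℂ} (hf : MemLp f 2) (hg : MemLp g 2) :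
    lpOp ψ j (f - g) = lpOp ψ j f - lpOp ψ j g := by
  ext x
  rw [Pi.sub_apply, lpOp_apply, lpOp_apply, lpOp_apply,
    ← integral_sub (integrable_dilate_mul ψ j hf x) (integrable_dilate_mul ψ j hg x)]
  simp [mul_sub]

/-- Cauchy-Schwarz against a dilate of a Schwartz function. -/
theorem exists_enorm_integral_dilate_mul_sq_le (ψ : 𝓢(E n, ℂ)) {N : ℝ} (hN : n < N) :
    ∃ C : ℝ≥0, ∀ (j : ℤ) (g : E n → ℂ), Measurable g →
      ‖∫ t, dilate ψ j t * g t‖ₑ ^ 2 ≤ C * ∫⁻ t, decayKernel N (2 ^ j) t * ‖g t‖ₑ ^ 2 := by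
  obtain ⟨C₁, h₁⟩ := exists_enorm_dilate_le ψ N
  obtain ⟨C₂, h₂⟩ := lintegral_decayKernel_le hN
  refine ⟨C₁ ^ 2 * C₂, fun j g hg => ?_⟩
  have hm := measurable_decayKernel (n := n) (N := N) (l := 2 ^ j) (by positivity)
  have h3 : ‖∫ t, dilate ψ j t * g t‖ₑ ≤ C₁ * ∫⁻ t, decayKernel N (2 ^ j) t * ‖g t‖ₑ := by
    refine (enorm_integral_le_lintegral_enorm _).trans ?_
    rw [← lintegral_const_mul' _ _ ENNReal.coe_ne_top]
    refine lintegral_mono fun t => ?_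
    rw [enorm_mul, ← mul_assoc]
    gcongr
    exact h₁ j t
  calc _ ≤ (C₁ * ∫⁻ t, decayKernel N (2 ^ j) t * ‖g t‖ₑ) ^ 2 := by gcongr
    _ ≤ C₁ ^ 2 * ((∫⁻ t, decayKernel (n := n) N (2 ^ j) t) *
          ∫⁻ t, decayKernel N (2 ^ j) t * ‖g t‖ₑ ^ 2) := by
        rw [mul_pow]
        gcongr
        exact sq_lintegral_mul_le hm.aemeasurable hg.enorm.aemeasurable
    _ ≤ _ := by
        push_cast
        rw [mul_assoc]
        gcongr
        exact h₂ _ (by positivity)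

/-- Young's inequality L¹ * L² → L²; the constant does not depend on j because the dominating
kernels have uniformly bounded integral. -/
theorem exists_eLpNorm_lpOp_le (ψ : 𝓢(E n, ℂ)) : ∃ C : ℝ≥0, ∀ (j : ℤ) (f : E n → ℂ),
    Measurable f → eLpNorm (lpOp ψ j f) 2 volume ≤ C * eLpNorm f 2 volume := by
  have hN : (n : ℝ) < n + 1 := by linarith
  obtain ⟨C₁, h₁⟩ := exists_enorm_integral_dilate_mul_sq_le ψ hN
  obtain ⟨C₂, h₂⟩ := lintegral_decayKernel_le hN
  refine ⟨NNReal.sqrt (C₁ * C₂), fun j f hf => ?_⟩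
  rw [← ENNReal.pow_le_pow_left_iff two_ne_zero, mul_pow, eLpNorm_two_sq, eLpNorm_two_sq,
    ← ENNReal.coe_pow, NNReal.sq_sqrt]
  have hm := measurable_decayKernel (n := n) (N := n + 1) (l := 2 ^ j) (by positivity)
  calc _ ≤ ∫⁻ x, C₁ * ∫⁻ t, decayKernel (n + 1) (2 ^ j) t * ‖f (x - t)‖ₑ ^ 2 :=
        lintegral_mono fun x => h₁ j (fun t => f (x - t)) (hf.comp (measurable_const.sub
          measurable_id))
    _ = C₁ * ∫⁻ t, ∫⁻ x, decayKernel (n + 1) (2 ^ j) t * ‖f (x - t)‖ₑ ^ 2 := by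
        have hp : Measurable fun p : E n × E n =>
            decayKernel (n + 1) (2 ^ j) p.2 * ‖f (p.1 - p.2)‖ₑ ^ 2 :=
          (hm.comp measurable_snd).mul ((hf.comp (measurable_fst.sub
            measurable_snd)).enorm.pow_const 2)
        rw [lintegral_const_mul _ hp.lintegral_prod_right', lintegral_lintegral_swap
          hp.aemeasurable]
    _ = C₁ * ∫⁻ t, decayKernel (n + 1) (2 ^ j) t * ∫⁻ x, ‖f x‖ₑ ^ 2 := by
        congr 1
        refine lintegral_congr fun t => ?_
        rw [lintegral_const_mul' (decayKernel (n + 1) (2 ^ j) t) _ ENNReal.ofReal_ne_top,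
          lintegral_sub_right_eq_self (fun x => ‖f x‖ₑ ^ 2) t]
    _ ≤ _ := by
        rw [lintegral_mul_const _ hm, ← mul_assoc]
        push_cast
        gcongr
        exact h₂ _ (by positivity)

theorem memLp_lpOp (ψ : 𝓢(E n, ℂ)) (j : ℤ) {f : E n → ℂ} (hfm : Measurable f) (hf : MemLp f 2) :
    MemLp (lpOp ψ j f) 2 := by
  obtain ⟨C, hC⟩ := exists_eLpNorm_lpOp_le ψ
  exact ⟨(measurable_lpOp ψ j hfm).aestronglyMeasurable,
    (hC j f hfm).trans_lt (ENNReal.mul_lt_top ENNReal.coe_lt_top hf.2)⟩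

theorem fourier_dilate (ψ : 𝓢(E n, ℂ)) (j : ℤ) (ξ : E n) :
    𝓕 (dilate ψ j) ξ = 𝓕 (ψ : E n → ℂ) ((2 : ℝ) ^ (-j) • ξ) := by
  rw [Real.fourier_eq', Real.fourier_eq']
  have h := Measure.integral_comp_smul volume (fun y : E n =>
    Complex.exp (↑(-2 * Real.pi * inner ℝ y ((2 : ℝ) ^ (-j) • ξ)) * Complex.I) • ψ y)
    ((2 : ℝ) ^ j)
  have h2 : (0 : ℝ) < (2 : ℝ) ^ j := by positivity
  rw [finrank_euclideanSpace_fin, abs_of_pos (by positivity), eq_comm,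
    inv_smul_eq_iff₀ (by positivity)] at h
  rw [h, ← integral_smul]
  refine integral_congr_ae (Filter.Eventually.of_forall fun x => ?_)
  simp only [dilate, inner_smul_left, inner_smul_right, smul_eq_mul, Complex.real_smul,
    conj_trivial]
  rw [zpow_neg, inv_mul_cancel_left₀ h2.ne', zpow_mul, zpow_natCast]
  push_cast
  ring

/-- Provides the reproducing function φ, whose transform is 1 on the whole frequency support of ψ:
the inverse Fourier transform of a smooth bump. -/
theorem exists_fourier_eq_one_on_ball (n : ℕ) : ∃ φ : 𝓢(E n, ℂ),
    ∀ ξ : E n, ‖ξ‖ ≤ 2 → 𝓕 (φ : E n → ℂ) ξ = 1 := by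
  let b : ContDiffBump (0 : E n) := ⟨2, 3, by norm_num, by norm_num⟩
  have h1 : HasCompactSupport fun x : E n => ((b x : ℝ) : ℂ) :=
    b.hasCompactSupport.comp_left (g := fun r : ℝ => (r : ℂ)) Complex.ofReal_zero
  have h2 : ContDiff ℝ ((⊤ : ℕ∞) : WithTop ℕ∞) fun x : E n => ((b x : ℝ) : ℂ) :=
    Complex.ofRealCLM.contDiff.comp b.contDiff
  refine ⟨𝓕⁻ (h1.toSchwartzMap h2), fun ξ hξ => ?_⟩
  rw [← SchwartzMap.fourier_coe, FourierTransform.fourier_fourierInv_eq]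
  change ((b ξ : ℝ) : ℂ) = 1
  rw [b.one_of_mem_closedBall (by simpa using hξ)]
  simp

/-- On the Fourier side convolution is a product, and the transform of φ_j equals 1 wherever that of
ψ_j is nonzero. -/
theorem lpOp_dilate_eq (ψ φ : 𝓢(E n, ℂ)) (j : ℤ)
    (hψ : tsupport (𝓕 (ψ : E n → ℂ)) ⊆ {ξ : E n | 1 / 2 ≤ ‖ξ‖ ∧ ‖ξ‖ ≤ 2})
    (hφ : ∀ ξ : E n, ‖ξ‖ ≤ 2 → 𝓕 (φ : E n → ℂ) ξ = 1) :
    lpOp φ j (dilate ψ j) = dilate ψ j := by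
  have h : SchwartzMap.convolution (ContinuousLinearMap.mul ℂ ℂ) (dilateS φ j) (dilateS ψ j)
      = dilateS ψ j := by
    apply (FourierTransform.fourierEquiv ℂ 𝓢(E n, ℂ)).injective
    change 𝓕 (SchwartzMap.convolution (ContinuousLinearMap.mul ℂ ℂ) (dilateS φ j)
      (dilateS ψ j)) = 𝓕 (dilateS ψ j)
    rw [SchwartzMap.fourier_convolution]
    ext ξ
    rw [SchwartzMap.pairing_apply_apply, SchwartzMap.fourier_coe, SchwartzMap.fourier_coe,
      coe_dilateS, coe_dilateS, fourier_dilate, fourier_dilate, ContinuousLinearMap.mul_apply']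
    by_cases hξ : (2 : ℝ) ^ (-j) • ξ ∈ tsupport (𝓕 (ψ : E n → ℂ))
    · rw [hφ _ (hψ hξ).2, one_mul]
    · rw [image_eq_zero_of_notMem_tsupport hξ, mul_zero]
  ext x
  have hx := SchwartzMap.convolution_apply (ContinuousLinearMap.mul ℂ ℂ) (dilateS φ j)
    (dilateS ψ j) x
  rw [h, coe_dilateS, coe_dilateS] at hx
  exact hx.symm

/-- Calderón reproducing formula on a single frequency annulus. -/
theorem lpOp_lpOp_eq (ψ φ : 𝓢(E n, ℂ)) (j : ℤ)
    (hψ : tsupport (𝓕 (ψ : E n → ℂ)) ⊆ {ξ : E n | 1 / 2 ≤ ‖ξ‖ ∧ ‖ξ‖ ≤ 2})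
    (hφ : ∀ ξ : E n, ‖ξ‖ ≤ 2 → 𝓕 (φ : E n → ℂ) ξ = 1)
    {f : E n → ℂ} (hfm : Measurable f) (hf : MemLp f 2) (x : E n) :
    lpOp φ j (lpOp ψ j f) x = lpOp ψ j f x := by
  -- Associativity of convolution requires |ψ_j| * |f| to be integrable against |φ_j|;
  -- Cauchy-Schwarz bounds it uniformly, which suffices as φ_j is integrable.
  have hb : ∃ C : ℝ, ∀ y, ‖(∫ t, ‖dilate ψ j t‖ * ‖f (y - t)‖)‖ ≤ C := by
    refine ⟨(∫ t, ‖dilate ψ j t‖ ^ (2:ℝ)) ^ (1 / (2:ℝ)) * (∫ t, ‖f t‖ ^ (2:ℝ)) ^ (1 / (2:ℝ)),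
      fun y => ?_⟩
    rw [Real.norm_of_nonneg (integral_nonneg fun t => by positivity),
      ← integral_sub_left_eq_self (fun t => ‖f t‖ ^ (2:ℝ)) volume y]
    exact integral_mul_norm_le_Lp_mul_Lq Real.HolderConjugate.two_two
      (by simpa using memLp_two_dilate ψ j) (by simpa using MemLp.comp_sub_left hf y)
  have hconv : (dilate φ j ⋆[ContinuousLinearMap.mul ℂ ℂ, volume] dilate ψ j)
      ⋆[ContinuousLinearMap.mul ℂ ℂ, volume] f = lpOp ψ j f := by
    change (lpOp φ j (dilate ψ j)) ⋆[ContinuousLinearMap.mul ℂ ℂ, volume] f = lpOp ψ j f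
    rw [lpOp_dilate_eq ψ φ j hψ hφ]; rfl
  rw [← congr_fun hconv x]
  symm
  refine convolution_assoc _ _ _ _ (fun a b c => by simp [mul_assoc])
    (integrable_dilate φ j).aestronglyMeasurable (integrable_dilate ψ j).aestronglyMeasurable
    hfm.aestronglyMeasurable ?_ ?_ ?_
  · exact Filter.Eventually.of_forall fun y => integrable_dilate_mul φ j (memLp_two_dilate ψ j) y
  · refine Filter.Eventually.of_forall fun y => ?_
    have := (integrable_dilate_mul ψ j hf y).norm
    simpa [ConvolutionExistsAt] using this
  · obtain ⟨C, hC⟩ := hb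
    have hm : StronglyMeasurable fun y => ∫ t, ‖dilate ψ j t‖ * ‖f (y - t)‖ := by
      refine StronglyMeasurable.integral_prod_right (ν := volume)
        (f := fun y t => ‖dilate ψ j t‖ * ‖f (y - t)‖) ?_
      refine Measurable.stronglyMeasurable ?_
      exact ((continuous_dilate ψ j).measurable.comp measurable_snd).norm.mul
        (hfm.comp (measurable_fst.sub measurable_snd)).norm
    have := (integrable_dilate φ j).norm.mul_bdd (g := fun t =>
      ∫ s, ‖dilate ψ j s‖ * ‖f (x - t - s)‖) (c := C)
      (hm.comp_measurable (measurable_const.sub measurable_id)).aestronglyMeasurable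
      (Filter.Eventually.of_forall fun t => hC _)
    exact this

/-! ### L² convergence of the Littlewood-Paley decomposition -/

theorem fourier_zero_eq_zero {ψ : 𝓢(E n, ℂ)} (hψ : IsLittlewoodPaley ψ) :
    𝓕 (ψ : E n → ℂ) 0 = 0 := by
  refine image_eq_zero_of_notMem_tsupport fun h => ?_
  have := (hψ.tsupport_fourier_subset h).1
  norm_num at this

/-- Both powers are at least 1/2 on the annulus, and the transform vanishes off it. The exponents ±1
are chosen only to match `tsum_min_rpow_le`. -/
theorem exists_norm_fourier_le_min {ψ : 𝓢(E n, ℂ)} (hψ : IsLittlewoodPaley ψ) :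
    ∃ C : ℝ, 0 ≤ C ∧ ∀ ξ, ‖𝓕 (ψ : E n → ℂ) ξ‖ ≤ C * min (‖ξ‖ ^ (-1 : ℝ)) (‖ξ‖ ^ (1 : ℝ)) := by
  obtain ⟨C, hC, h⟩ := exists_norm_le_one_add_rpow (𝓕 ψ) 0
  refine ⟨C * 2, by positivity, fun ξ => ?_⟩
  by_cases hξ : ξ ∈ tsupport (𝓕 (ψ : E n → ℂ))
  · obtain ⟨h1, h2⟩ := hψ.tsupport_fourier_subset hξ
    have := h ξ
    rw [SchwartzMap.fourier_coe] at this
    refine this.trans ?_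
    rw [mul_assoc]
    gcongr
    rw [neg_zero, Real.rpow_zero, Real.rpow_one, Real.rpow_neg_one]
    have : 1 / 2 ≤ min (‖ξ‖⁻¹) ‖ξ‖ := le_min
      (by rw [one_div]; exact inv_anti₀ (by linarith) h2) h1
    linarith
  · rw [image_eq_zero_of_notMem_tsupport hξ, norm_zero]
    positivity

/-- A bound on the partial multipliers uniform in s gives, by Plancherel, uniform L² bounds for
partial sums, and it also supplies the dominating function in the convergence proof. -/
theorem exists_norm_sum_fourier_dilate_le {ψ : 𝓢(E n, ℂ)} (hψ : IsLittlewoodPaley ψ) :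
    ∃ C : ℝ≥0, ∀ (s : Finset ℤ) (ξ : E n), ‖∑ j ∈ s, 𝓕 (dilate ψ j) ξ‖ ≤ C := by
  obtain ⟨C₁, hC₁, h₁⟩ := exists_norm_fourier_le_min hψ
  obtain ⟨C₂, h₂⟩ := tsum_min_rpow_le one_pos one_pos
  refine ⟨C₁.toNNReal * C₂, fun s ξ => ?_⟩
  rcases eq_or_ne ξ 0 with rfl | hξ
  · simp only [fourier_dilate, smul_zero, fourier_zero_eq_zero hψ]
    simp only [Finset.sum_const_zero, norm_zero]
    positivity
  rw [← toReal_enorm]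
  refine ENNReal.toReal_le_coe_of_le_coe ?_
  calc ‖∑ j ∈ s, 𝓕 (dilate ψ j) ξ‖ₑ ≤ ∑ j ∈ s, ‖𝓕 (dilate ψ j) ξ‖ₑ := enorm_sum_le _ _
    _ ≤ ∑' j : ℤ, ‖𝓕 (dilate ψ j) ξ‖ₑ := ENNReal.sum_le_tsum _
    -- The reflection is needed because dilation by 2^j in space is dilation by 2^(-j) in frequency.
    _ = ∑' j : ℤ, ‖𝓕 (dilate ψ (-j)) ξ‖ₑ :=
        ((Equiv.neg ℤ).tsum_eq fun j : ℤ => ‖𝓕 (dilate ψ j) ξ‖ₑ).symm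
    _ ≤ ∑' j : ℤ, C₁.toNNReal * ENNReal.ofReal
          (min (((2 : ℝ) ^ j * ‖ξ‖) ^ (-1 : ℝ)) (((2 : ℝ) ^ j * ‖ξ‖) ^ (1 : ℝ))) := by
        refine ENNReal.tsum_le_tsum fun j => ?_
        rw [fourier_dilate, neg_neg, ← ofReal_norm, ← ENNReal.ofReal.eq_1,
          ← ENNReal.ofReal_mul hC₁]
        refine ENNReal.ofReal_le_ofReal ((h₁ _).trans (le_of_eq ?_))
        rw [norm_smul, Real.norm_of_nonneg (by positivity)]
    _ ≤ _ := by
        rw [ENNReal.tsum_mul_left, ENNReal.coe_mul]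
        gcongr
        exact h₂ _ (norm_pos_iff.2 hξ)

/-- The partial sums of the Littlewood-Paley decomposition. -/
noncomputable def lpSum (ψ : 𝓢(E n, ℂ)) (s : Finset ℤ) (f : E n → ℂ) (x : E n) : ℂ :=
  ∑ j ∈ s, lpOp ψ j f x

theorem measurable_lpSum (ψ : 𝓢(E n, ℂ)) (s : Finset ℤ) {f : E n → ℂ} (hf : Measurable f) :
    Measurable (lpSum ψ s f) :=
  Finset.measurable_fun_sum s fun j _ => measurable_lpOp ψ j hf

theorem lpSum_sub (ψ : 𝓢(E n, ℂ)) (s : Finset ℤ) {f g : E n → ℂ} (hf : MemLp f 2)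
    (hg : MemLp g 2) : lpSum ψ s (f - g) = lpSum ψ s f - lpSum ψ s g := by
  ext x
  simp [lpSum, lpOp_sub ψ _ hf hg]

/-- The partial sums, for a Schwartz function, as a Schwartz function. -/
noncomputable def lpSumS (ψ : 𝓢(E n, ℂ)) (s : Finset ℤ) (g : 𝓢(E n, ℂ)) : 𝓢(E n, ℂ) :=
  ∑ j ∈ s, SchwartzMap.convolution (ContinuousLinearMap.mul ℂ ℂ) (dilateS ψ j) g

theorem coe_lpSumS (ψ : 𝓢(E n, ℂ)) (s : Finset ℤ) (g : 𝓢(E n, ℂ)) :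
    (lpSumS ψ s g : E n → ℂ) = lpSum ψ s g := by
  ext x
  rw [lpSumS, lpSum, sum_apply]
  refine Finset.sum_congr rfl fun j _ => ?_
  rw [SchwartzMap.convolution_apply, coe_dilateS]
  rfl

theorem fourier_lpSumS (ψ : 𝓢(E n, ℂ)) (s : Finset ℤ) (g : 𝓢(E n, ℂ)) (ξ : E n) :
    𝓕 (lpSumS ψ s g) ξ = (∑ j ∈ s, 𝓕 (dilate ψ j) ξ) * 𝓕 g ξ := by
  have h : 𝓕 (lpSumS ψ s g) = ∑ j ∈ s,
      𝓕 (SchwartzMap.convolution (ContinuousLinearMap.mul ℂ ℂ) (dilateS ψ j) g) :=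
    map_sum (FourierTransform.fourierEquiv ℂ 𝓢(E n, ℂ)) _ _
  rw [h, sum_apply, Finset.sum_mul]
  refine Finset.sum_congr rfl fun j _ => ?_
  rw [SchwartzMap.fourier_convolution, SchwartzMap.pairing_apply_apply, SchwartzMap.fourier_coe,
    coe_dilateS, ContinuousLinearMap.mul_apply']

theorem eLpNorm_fourier_eq (g : 𝓢(E n, ℂ)) :
    eLpNorm (⇑(𝓕 g : 𝓢(E n, ℂ))) 2 volume = eLpNorm (⇑g) 2 volume := by
  have h := SchwartzMap.norm_fourier_toL2_eq g
  rw [SchwartzMap.norm_toLp, SchwartzMap.norm_toLp] at h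
  have h1 : MemLp (⇑(𝓕 g : 𝓢(E n, ℂ))) 2 volume := SchwartzMap.memLp _ 2 volume
  have h2 : MemLp (⇑g) 2 volume := SchwartzMap.memLp _ 2 volume
  exact (ENNReal.toReal_eq_toReal_iff' h1.2.ne h2.2.ne).1 h

theorem exists_eLpNorm_lpSum_schwartz_le {ψ : 𝓢(E n, ℂ)} (hψ : IsLittlewoodPaley ψ) :
    ∃ C : ℝ≥0, ∀ (s : Finset ℤ) (g : 𝓢(E n, ℂ)),
      eLpNorm (lpSum ψ s g) 2 volume ≤ C * eLpNorm g 2 volume := by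
  obtain ⟨C, hC⟩ := exists_norm_sum_fourier_dilate_le hψ
  refine ⟨C, fun s g => ?_⟩
  rw [← coe_lpSumS, ← eLpNorm_fourier_eq, ← eLpNorm_fourier_eq g]
  refine eLpNorm_le_nnreal_smul_eLpNorm_of_ae_le_mul
    (Filter.Eventually.of_forall fun ξ => ?_) 2 |>.trans (le_of_eq rfl)
  rw [fourier_lpSumS, ← NNReal.coe_le_coe]
  simp only [coe_nnnorm, norm_mul, NNReal.coe_mul]
  gcongr
  exact hC s ξ

theorem exists_seq_schwartz_tendsto {f : E n → ℂ} (hf : MemLp f 2) :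
    ∃ g : ℕ → 𝓢(E n, ℂ),
      Filter.Tendsto (fun k => eLpNorm (f - ⇑(g k)) 2 volume) Filter.atTop (nhds 0) := by
  have hd := SchwartzMap.denseRange_toLpCLM (E := E n) (F := ℂ) (p := 2) ENNReal.ofNat_ne_top
    (μ := volume)
  have h : hf.toLp f ∈ closure (Set.range (SchwartzMap.toLpCLM ℝ (E := E n) ℂ 2 volume)) :=
    hd _
  obtain ⟨u, hu, hlim⟩ := mem_closure_iff_seq_limit.1 h
  choose g hg using hu
  refine ⟨g, ?_⟩
  have := (tendsto_iff_edist_tendsto_0).1 hlim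
  refine this.congr fun k => ?_
  rw [← hg k, edist_comm, SchwartzMap.toLpCLM_apply, SchwartzMap.toLp, Lp.edist_toLp_toLp]

theorem eLpNorm_lpSum_le_card {ψ : 𝓢(E n, ℂ)} {C : ℝ≥0} (hC : ∀ (j : ℤ) (f : E n → ℂ),
    Measurable f → eLpNorm (lpOp ψ j f) 2 volume ≤ C * eLpNorm f 2 volume) (s : Finset ℤ)
    {f : E n → ℂ} (hf : Measurable f) :
    eLpNorm (lpSum ψ s f) 2 volume ≤ s.card * C * eLpNorm f 2 volume := by
  have : lpSum ψ s f = ∑ j ∈ s, lpOp ψ j f := by ext x; simp [lpSum]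
  rw [this]
  refine (eLpNorm_sum_le (fun j _ => (measurable_lpOp ψ j hf).aestronglyMeasurable)
    one_le_two).trans ?_
  refine (Finset.sum_le_sum fun j _ => hC j f hf).trans (le_of_eq ?_)
  rw [Finset.sum_const, nsmul_eq_mul, mul_assoc]

/-- Density of Schwartz functions extends the uniform bound to L². The cruder bound
`eLpNorm_lpSum_le_card` controls the approximation error: it depends on s, but s stays fixed in the
limit. -/
theorem exists_eLpNorm_lpSum_le {ψ : 𝓢(E n, ℂ)} (hψ : IsLittlewoodPaley ψ) :
    ∃ C : ℝ≥0, ∀ (s : Finset ℤ) (f : E n → ℂ), Measurable f → MemLp f 2 →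
      eLpNorm (lpSum ψ s f) 2 volume ≤ C * eLpNorm f 2 volume := by
  obtain ⟨C₁, h₁⟩ := exists_eLpNorm_lpSum_schwartz_le hψ
  obtain ⟨C₂, h₂⟩ := exists_eLpNorm_lpOp_le ψ
  refine ⟨C₁, fun s f hfm hf => ?_⟩
  obtain ⟨g, hg⟩ := exists_seq_schwartz_tendsto hf
  set K : ℝ≥0 := s.card * C₂ + C₁ with hK
  have hlim : Filter.Tendsto (fun k => C₁ * eLpNorm f 2 volume + K * eLpNorm (f - ⇑(g k)) 2 volume)
      Filter.atTop (nhds (C₁ * eLpNorm f 2 volume + K * 0)) :=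
    (ENNReal.Tendsto.const_mul hg (Or.inr ENNReal.coe_ne_top)).const_add _
  rw [mul_zero, add_zero] at hlim
  refine ge_of_tendsto' hlim fun k => ?_
  have hgm : Measurable (g k) := (g k).continuous.measurable
  have hgL : MemLp (g k) 2 := (g k).memLp 2
  have e1 : lpSum ψ s f = lpSum ψ s (f - ⇑(g k)) + lpSum ψ s (g k) := by
    rw [lpSum_sub ψ s hf hgL, sub_add_cancel]
  have e2 : (g k : E n → ℂ) = f - (f - ⇑(g k)) := by rw [sub_sub_cancel]
  calc eLpNorm (lpSum ψ s f) 2 volume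
      ≤ eLpNorm (lpSum ψ s (f - ⇑(g k))) 2 volume + eLpNorm (lpSum ψ s (g k)) 2 volume := by
        rw [e1]
        exact eLpNorm_add_le (measurable_lpSum ψ s (hfm.sub hgm)).aestronglyMeasurable
          (measurable_lpSum ψ s hgm).aestronglyMeasurable one_le_two
    _ ≤ s.card * C₂ * eLpNorm (f - ⇑(g k)) 2 volume +
          C₁ * (eLpNorm f 2 volume + eLpNorm (f - ⇑(g k)) 2 volume) := by
        refine add_le_add (eLpNorm_lpSum_le_card h₂ s (hfm.sub hgm)) ((h₁ s (g k)).trans ?_)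
        gcongr
        conv_lhs => rw [e2]
        exact eLpNorm_sub_le hfm.aestronglyMeasurable (hfm.sub hgm).aestronglyMeasurable
          one_le_two
    _ = _ := by rw [hK]; push_cast; ring

/-- Plancherel turns the error into a weighted integral of |∑ - 1|² over frequencies, and dominated
convergence applies. The excluded frequency 0 is a null set since n ≥ 1. -/
theorem tendsto_eLpNorm_lpSum_sub_schwartz {ψ : 𝓢(E n, ℂ)} (hn : 1 ≤ n)
    (hψ : IsLittlewoodPaley ψ) (g : 𝓢(E n, ℂ)) :
    Filter.Tendsto (fun s => eLpNorm (lpSum ψ s g - ⇑g) 2 volume) Filter.atTop (nhds 0) := by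
  obtain ⟨C, hC⟩ := exists_norm_sum_fourier_dilate_le hψ
  have hrw : ∀ s, eLpNorm (lpSum ψ s g - ⇑g) 2 volume ^ 2 =
      ∫⁻ ξ, ‖(∑ j ∈ s, 𝓕 (dilate ψ j) ξ - 1) * 𝓕 g ξ‖ₑ ^ 2 := fun s => by
    have h1 : lpSum ψ s g - ⇑g = ((lpSumS ψ s g - g : 𝓢(E n, ℂ)) : E n → ℂ) := by
      ext x; rw [← coe_lpSumS]; simp
    rw [h1, ← eLpNorm_fourier_eq, eLpNorm_two_sq]
    refine lintegral_congr fun ξ => ?_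
    have h2 : 𝓕 (lpSumS ψ s g - g) = 𝓕 (lpSumS ψ s g) - 𝓕 g :=
      map_sub (FourierTransform.fourierEquiv ℂ 𝓢(E n, ℂ)) _ _
    rw [h2, sub_apply, fourier_lpSumS, sub_mul, one_mul]
  have hnt : Nontrivial (E n) := by
    have : Nonempty (Fin n) := ⟨⟨0, hn⟩⟩
    infer_instance
  have hlim : Filter.Tendsto (fun s => eLpNorm (lpSum ψ s g - ⇑g) 2 volume ^ 2) Filter.atTop
      (nhds 0) := by
    simp_rw [hrw]
    have hmeas : ∀ j, Measurable (𝓕 (dilate ψ j)) := fun j => by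
      rw [← coe_dilateS]
      exact (𝓕 (dilateS ψ j)).continuous.measurable
    have hgF : Measurable (⇑(𝓕 g : 𝓢(E n, ℂ))) := (SchwartzMap.continuous _).measurable
    have hgL : MemLp (⇑(𝓕 g : 𝓢(E n, ℂ))) 2 volume := SchwartzMap.memLp _ 2 volume
    have := tendsto_lintegral_filter_of_dominated_convergence (μ := volume) (l := Filter.atTop)
      (F := fun (s : Finset ℤ) ξ => ‖(∑ j ∈ s, 𝓕 (dilate ψ j) ξ - 1) * 𝓕 g ξ‖ₑ ^ 2)
      (f := fun _ => 0) (fun ξ => ((C + 1 : ℝ≥0) : ℝ≥0∞) ^ 2 * ‖𝓕 g ξ‖ₑ ^ 2)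
      (Filter.Eventually.of_forall fun s => ?_)
      (Filter.Eventually.of_forall fun s => Filter.Eventually.of_forall fun ξ => ?_) ?_ ?_
    · simpa using this
    · exact ((((Finset.measurable_fun_sum s fun j _ => hmeas j).sub_const 1).mul
        hgF).enorm.pow_const 2)
    · simp only [enorm_mul, mul_pow]
      gcongr
      rw [← ofReal_norm, ENNReal.ofReal_le_iff_le_toReal ENNReal.coe_ne_top]
      refine (norm_sub_le _ _).trans ?_
      rw [ENNReal.coe_toReal]
      simpa using hC s ξ
    · rw [lintegral_const_mul' _ _ (by finiteness), ← eLpNorm_two_sq]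
      exact ENNReal.mul_ne_top (by finiteness) (ENNReal.pow_ne_top hgL.2.ne)
    · filter_upwards [Measure.ae_ne volume (0 : E n)] with ξ hξ
      have h1 : Filter.Tendsto (fun s : Finset ℤ =>
          (∑ j ∈ s, 𝓕 (dilate ψ j) ξ - 1) * 𝓕 g ξ) Filter.atTop (nhds ((1 - 1) * 𝓕 g ξ)) :=
        (Filter.Tendsto.sub_const (hψ.hasSum_fourier ξ hξ) 1).mul_const _
      have h2 := (ENNReal.continuous_pow 2).continuousAt.tendsto.comp
        ((continuous_enorm.tendsto _).comp h1)
      rwa [sub_self, zero_mul, enorm_zero, zero_pow two_ne_zero] at h2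
  have h3 := (ENNReal.continuous_rpow_const (y := 1 / 2)).continuousAt.tendsto.comp hlim
  rw [ENNReal.zero_rpow_of_pos (by norm_num)] at h3
  refine h3.congr fun s => ?_
  simp only [Function.comp]
  rw [← ENNReal.rpow_two, ← ENNReal.rpow_mul]
  norm_num

/-- The Littlewood-Paley decomposition converges in `L²`. -/
theorem tendsto_eLpNorm_lpSum_sub {ψ : 𝓢(E n, ℂ)} (hn : 1 ≤ n) (hψ : IsLittlewoodPaley ψ)
    {f : E n → ℂ} (hfm : Measurable f) (hf : MemLp f 2) :
    Filter.Tendsto (fun s => eLpNorm (lpSum ψ s f - f) 2 volume) Filter.atTop (nhds 0) := by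
  obtain ⟨C, hC⟩ := exists_eLpNorm_lpSum_le hψ
  obtain ⟨g, hg⟩ := exists_seq_schwartz_tendsto hf
  have hle : ∀ k s, eLpNorm (lpSum ψ s f - f) 2 volume ≤
      (C + 1) * eLpNorm (f - ⇑(g k)) 2 volume + eLpNorm (lpSum ψ s (g k) - ⇑(g k)) 2 volume := by
    intro k s
    have hgm : Measurable (g k) := (g k).continuous.measurable
    have hgL : MemLp (g k) 2 := (g k).memLp 2
    have e : lpSum ψ s f - f =
        (lpSum ψ s (f - ⇑(g k)) - (f - ⇑(g k))) + (lpSum ψ s (g k) - ⇑(g k)) := by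
      rw [lpSum_sub ψ s hf hgL]; abel
    rw [e]
    have hm1 := measurable_lpSum ψ s (hfm.sub hgm)
    have hm2 := measurable_lpSum ψ s hgm
    refine (eLpNorm_add_le (hm1.sub (hfm.sub hgm)).aestronglyMeasurable
      (hm2.sub hgm).aestronglyMeasurable one_le_two).trans ?_
    gcongr
    refine (eLpNorm_sub_le hm1.aestronglyMeasurable (hfm.sub hgm).aestronglyMeasurable
      one_le_two).trans ?_
    rw [add_mul, one_mul]
    gcongr
    exact hC s _ (hfm.sub hgm) (hf.sub hgL)
  rw [ENNReal.tendsto_nhds_zero]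
  intro ε hε
  have h1 : Filter.Tendsto (fun k => ((C : ℝ≥0∞) + 1) * eLpNorm (f - ⇑(g k)) 2 volume) Filter.atTop
      (nhds 0) := by
    simpa using ENNReal.Tendsto.const_mul (a := (C : ℝ≥0∞) + 1) hg (Or.inr (by finiteness))
  obtain ⟨k, hk⟩ := ((ENNReal.tendsto_nhds_zero.1 h1) (ε / 2) (ENNReal.half_pos hε.ne')).exists
  filter_upwards [(ENNReal.tendsto_nhds_zero.1
    (tendsto_eLpNorm_lpSum_sub_schwartz hn hψ (g k))) (ε / 2) (ENNReal.half_pos hε.ne')] with s hs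
  calc _ ≤ _ := hle k s
    _ ≤ ε / 2 + ε / 2 := add_le_add hk hs
    _ = ε := ENNReal.add_halves ε

/-- A sequence of partial sums converges almost everywhere, and every partial sum of differences is
below the full sum. A single full-measure set G serves x and y separately, so no null set in the
product is needed. -/
theorem ae_forall_enorm_sub_le_tsum {ψ : 𝓢(E n, ℂ)} (hn : 1 ≤ n) (hψ : IsLittlewoodPaley ψ)
    {f : E n → ℂ} (hfm : Measurable f) (hf : MemLp f 2) :
    ∃ G : Set (E n), (∀ᵐ x, x ∈ G) ∧ ∀ x ∈ G, ∀ y ∈ G,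
      ‖f x - f y‖ₑ ≤ ∑' j : ℤ, ‖lpOp ψ j f x - lpOp ψ j f y‖ₑ := by
  obtain ⟨s, -, hae⟩ := (tendstoInMeasure_of_tendsto_eLpNorm (two_ne_zero)
    (fun s => (measurable_lpSum ψ s hfm).aestronglyMeasurable) hfm.aestronglyMeasurable
    (tendsto_eLpNorm_lpSum_sub hn hψ hfm hf)).exists_seq_tendsto_ae'
  refine ⟨{x | Filter.Tendsto (fun i => lpSum ψ (s i) f x) Filter.atTop (nhds (f x))}, hae,
    fun x hx y hy => ?_⟩
  refine le_of_tendsto' ((continuous_enorm.tendsto _).comp (Filter.Tendsto.sub hx hy))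
    fun i => ?_
  simp only [Function.comp, lpSum, ← Finset.sum_sub_distrib]
  exact (enorm_sum_le _ _).trans (ENNReal.sum_le_tsum _)

/-! ### Squared norms and their bounds on single cubes -/

/-- The square of `qNorm`. -/
noncomputable def qSq (α : ℝ) (f : E n → ℂ) : ℝ≥0∞ :=
  ⨆ I : Cube n, ENNReal.ofReal (I.side ^ (2 * α - (n : ℝ))) *
    ∫⁻ x in I.toSet, ∫⁻ y in I.toSet,
      ‖f x - f y‖ₑ ^ 2 / ENNReal.ofReal (‖x - y‖ ^ (2 * α + (n : ℝ)))

/-- The square of `lpNorm`. -/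
noncomputable def lpSq (ψ : 𝓢(E n, ℂ)) (α : ℝ) (f : E n → ℂ) : ℝ≥0∞ :=
  ⨆ I : Cube n, ENNReal.ofReal (I.side ^ (2 * α - (n : ℝ))) *
    ∑' j : {j : ℤ // 1 ≤ (2 : ℝ) ^ j * I.side},
      ENNReal.ofReal (((2 : ℝ) ^ (j : ℤ)) ^ (2 * α)) * ∫⁻ x in I.toSet, ‖lpOp ψ j f x‖ₑ ^ 2

theorem qNorm_eq (α : ℝ) (f : E n → ℂ) : qNorm α f = qSq α f ^ (1 / 2 : ℝ) := rfl

theorem neg_logb_le_iff {l : ℝ} (hl : 0 < l) (j : ℤ) :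
    -Real.logb 2 l ≤ (j : ℝ) ↔ 1 ≤ (2 : ℝ) ^ j * l := by
  rw [← Real.logb_inv, Real.logb_le_iff_le_rpow (by norm_num) (by positivity), Real.rpow_intCast,
    inv_le_iff_one_le_mul₀ hl]

theorem lpNorm_eq (hn : 1 ≤ n) (ψ : 𝓢(E n, ℂ)) (α : ℝ) (f : E n → ℂ) :
    lpNorm ψ α f = lpSq ψ α f ^ (1 / 2 : ℝ) := by
  rw [lpNorm, lpSq]
  congr 1
  refine iSup_congr fun I => ?_
  have hl := I.side_pos
  congr 1
  · rw [I.volume_toSet, ENNReal.ofReal_rpow_of_pos (by positivity), one_div,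
      ← ENNReal.ofReal_inv_of_pos (by positivity), ← Real.rpow_natCast, ← Real.rpow_mul hl.le,
      ← Real.rpow_neg hl.le]
    congr 2
    have : (n : ℝ) ≠ 0 := by positivity
    field_simp
    ring
  · rw [← (Equiv.subtypeEquivRight (neg_logb_le_iff hl)).tsum_eq]
    refine tsum_congr fun j => ?_
    rw [eLpNorm_two_sq, mul_comm (2 * α), Real.rpow_mul (by norm_num), Real.rpow_intCast]
    rfl

theorem le_ofReal_rpow_mul {l p : ℝ} (hl : 0 < l) {A B : ℝ≥0∞}
    (h : ENNReal.ofReal (l ^ (-p)) * A ≤ B) : A ≤ ENNReal.ofReal (l ^ p) * B := by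
  calc A = ENNReal.ofReal (l ^ p) * (ENNReal.ofReal (l ^ (-p)) * A) := by
        rw [← mul_assoc, ← ENNReal.ofReal_mul (by positivity), ← Real.rpow_add hl]
        simp
    _ ≤ _ := by gcongr

theorem ofReal_rpow_neg_mul_le {l p : ℝ} (hl : 0 < l) {A B : ℝ≥0∞}
    (h : A ≤ ENNReal.ofReal (l ^ p) * B) : ENNReal.ofReal (l ^ (-p)) * A ≤ B := by
  calc _ ≤ ENNReal.ofReal (l ^ (-p)) * (ENNReal.ofReal (l ^ p) * B) := by gcongr
    _ = B := by
        rw [← mul_assoc, ← ENNReal.ofReal_mul (by positivity), ← Real.rpow_add hl]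
        simp

theorem lintegral_cube_le_qSq (α : ℝ) (f : E n → ℂ) (I : Cube n) :
    ∫⁻ x in I.toSet, ∫⁻ y in I.toSet,
      ‖f x - f y‖ₑ ^ 2 / ENNReal.ofReal (‖x - y‖ ^ (2 * α + (n : ℝ))) ≤
      ENNReal.ofReal (I.side ^ ((n : ℝ) - 2 * α)) * qSq α f := by
  refine le_ofReal_rpow_mul I.side_pos ?_
  rw [neg_sub]
  exact le_iSup (fun I : Cube n => ENNReal.ofReal (I.side ^ (2 * α - (n : ℝ))) *
    ∫⁻ x in I.toSet, ∫⁻ y in I.toSet,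
      ‖f x - f y‖ₑ ^ 2 / ENNReal.ofReal (‖x - y‖ ^ (2 * α + (n : ℝ)))) I

theorem tsum_cube_le_lpSq (ψ : 𝓢(E n, ℂ)) (α : ℝ) (f : E n → ℂ) (I : Cube n) :
    ∑' j : {j : ℤ // 1 ≤ (2 : ℝ) ^ j * I.side},
      ENNReal.ofReal (((2 : ℝ) ^ (j : ℤ)) ^ (2 * α)) * ∫⁻ x in I.toSet, ‖lpOp ψ j f x‖ₑ ^ 2 ≤
      ENNReal.ofReal (I.side ^ ((n : ℝ) - 2 * α)) * lpSq ψ α f := by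
  refine le_ofReal_rpow_mul I.side_pos ?_
  rw [neg_sub]
  exact le_iSup (fun I : Cube n => ENNReal.ofReal (I.side ^ (2 * α - (n : ℝ))) *
    ∑' j : {j : ℤ // 1 ≤ (2 : ℝ) ^ j * I.side},
      ENNReal.ofReal (((2 : ℝ) ^ (j : ℤ)) ^ (2 * α)) * ∫⁻ x in I.toSet, ‖lpOp ψ j f x‖ₑ ^ 2) I

/-- The enlarged side is at most 3·2^k times the old one, and n - 2α ≤ n even when it is negative.
-/
theorem lintegral_dyadic_expand_le_qSq {α : ℝ} (hα : 0 < α) (f : E n → ℂ) (I : Cube n) (k : ℕ)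
    (hr : 0 ≤ 2 ^ k * I.side) :
    ∫⁻ x in (I.expand _ hr).toSet, ∫⁻ y in (I.expand _ hr).toSet,
      ‖f x - f y‖ₑ ^ 2 / ENNReal.ofReal (‖x - y‖ ^ (2 * α + (n : ℝ))) ≤
      ENNReal.ofReal (3 ^ n * 2 ^ ((n : ℝ) * k)) *
        (ENNReal.ofReal (I.side ^ ((n : ℝ) - 2 * α)) * qSq α f) := by
  refine (lintegral_cube_le_qSq α f _).trans ?_
  rw [← mul_assoc, ← ENNReal.ofReal_mul (by positivity)]
  gcongr
  have h1 : (1 : ℝ) ≤ 2 ^ k := one_le_pow₀ (by norm_num)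
  have : (I.expand _ hr).side = I.side * (1 + 2 * 2 ^ k) := by simp only [Cube.expand]; ring
  rw [this, mul_comm _ (I.side ^ _)]
  refine (mul_rpow_sub_le I.side_pos (by linarith) hα).trans ?_
  have := I.side_pos
  gcongr
  rw [mul_comm (n : ℝ), Real.rpow_mul (by norm_num), Real.rpow_natCast, Real.rpow_natCast,
    ← mul_pow]
  gcongr
  linarith

/-! ### Littlewood-Paley norm bounded by the Q norm -/

/-- With a = 2α+n and s = 2^j‖y‖, the prefactor 2^(ja) is s^a ‖y‖^(-a). Decay of order 2a makes
s^a(1+s)^(-2a) summable in j from both sides, while the remaining order M becomes decay in ‖y‖/l,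
since 2^j l ≥ 1 forces s ≥ ‖y‖/l. -/
theorem tsum_decayKernel_le {α : ℝ} (hα : 0 < α) (M : ℝ) (hM : 0 ≤ M) :
    ∃ C : ℝ≥0, ∀ (l : ℝ), 0 < l → ∀ y : E n, y ≠ 0 →
      ∑' j : {j : ℤ // 1 ≤ (2 : ℝ) ^ j * l}, ENNReal.ofReal (((2 : ℝ) ^ (j : ℤ)) ^ (2 * α)) *
        decayKernel (2 * (2 * α + n) + M) (2 ^ (j : ℤ)) y ≤
      C * (ENNReal.ofReal (‖y‖ ^ (-(2 * α + n))) * ∑' k : ℕ,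
        ENNReal.ofReal ((2 : ℝ) ^ (-M * k)) *
          (Metric.closedBall (0 : E n) (2 ^ k * l)).indicator 1 y) := by
  set a : ℝ := 2 * α + n with ha
  have ha0 : 0 < a := by positivity
  obtain ⟨C, hC⟩ := tsum_min_rpow_le ha0 ha0
  refine ⟨C * Real.toNNReal (2 ^ M), fun l hl y hy => ?_⟩
  have hr : 0 < ‖y‖ := norm_pos_iff.2 hy
  have hterm : ∀ j : {j : ℤ // 1 ≤ (2 : ℝ) ^ j * l},
      ENNReal.ofReal (((2 : ℝ) ^ (j : ℤ)) ^ (2 * α)) *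
        decayKernel (2 * a + M) (2 ^ (j : ℤ)) y ≤
      ENNReal.ofReal (min (((2 : ℝ) ^ (j : ℤ) * ‖y‖) ^ (-a)) (((2 : ℝ) ^ (j : ℤ) * ‖y‖) ^ a)) *
        (ENNReal.ofReal (‖y‖ ^ (-a)) * ENNReal.ofReal ((1 + ‖y‖ / l) ^ (-M))) := by
    rintro ⟨j, hj⟩
    rw [decayKernel, ← ENNReal.ofReal_mul (by positivity), ← ENNReal.ofReal_mul (by positivity),
      ← ENNReal.ofReal_mul (by positivity)]
    apply ENNReal.ofReal_le_ofReal
    simp only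
    set b : ℝ := (2 : ℝ) ^ j with hb
    have hb0 : 0 < b := by positivity
    set s := b * ‖y‖ with hs
    have hs0 : 0 < s := by positivity
    have e1 : b ^ (2 * α) * (b ^ n * (1 + s) ^ (-(2 * a + M))) =
        (s ^ a * (1 + s) ^ (-(2 * a))) * (‖y‖ ^ (-a) * (1 + s) ^ (-M)) := by
      rw [hs, Real.mul_rpow hb0.le hr.le, ← hs, neg_add, Real.rpow_add (by positivity),
        Real.rpow_neg hr.le, ha, Real.rpow_add hb0, Real.rpow_natCast]
      field_simp
    rw [e1]
    have e2 : s ^ a * (1 + s) ^ (-(2 * a)) ≤ min (s ^ (-a)) (s ^ a) := by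
      refine le_min ?_ ?_
      · calc s ^ a * (1 + s) ^ (-(2 * a)) ≤ s ^ a * s ^ (-(2 * a)) := by
              gcongr ?_ * ?_
              exact Real.rpow_le_rpow_of_nonpos hs0 (by linarith) (by linarith)
          _ = s ^ (-a) := by rw [← Real.rpow_add hs0]; ring_nf
      · exact mul_le_of_le_one_right (by positivity)
          (Real.rpow_le_one_of_one_le_of_nonpos (by linarith) (by linarith))
    have e3 : (1 + s) ^ (-M) ≤ (1 + ‖y‖ / l) ^ (-M) := by
      refine Real.rpow_le_rpow_of_nonpos (by positivity) ?_ (by linarith)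
      have : ‖y‖ / l ≤ s := by
        rw [div_le_iff₀ hl, hs]
        nlinarith
      linarith
    gcongr
  calc _ ≤ _ := ENNReal.tsum_le_tsum hterm
    _ = (∑' j : {j : ℤ // 1 ≤ (2 : ℝ) ^ j * l}, ENNReal.ofReal (min (((2 : ℝ) ^ (j : ℤ) * ‖y‖) ^ (-a))
          (((2 : ℝ) ^ (j : ℤ) * ‖y‖) ^ a))) *
        (ENNReal.ofReal (‖y‖ ^ (-a)) * ENNReal.ofReal ((1 + ‖y‖ / l) ^ (-M))) :=
        ENNReal.tsum_mul_right
    _ ≤ C * (ENNReal.ofReal (‖y‖ ^ (-a)) * (ENNReal.ofReal (2 ^ M) * ∑' k : ℕ,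
          if ‖y‖ / l ≤ (2 : ℝ) ^ k then ENNReal.ofReal ((2 : ℝ) ^ (-M * k)) else 0)) := by
        gcongr ?_ * (_ * ?_)
        · exact (ENNReal.tsum_comp_le_tsum_of_injective Subtype.val_injective
            (fun j : ℤ => ENNReal.ofReal (min (((2 : ℝ) ^ j * ‖y‖) ^ (-a))
              (((2 : ℝ) ^ j * ‖y‖) ^ a)))).trans (hC _ hr)
        · exact ofReal_one_add_rpow_neg_le hM (by positivity)
    _ = _ := by
        rw [ENNReal.coe_mul, ← ENNReal.ofReal.eq_1, mul_left_comm (ENNReal.ofReal (‖y‖ ^ (-a))),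
          ← mul_assoc (C : ℝ≥0∞)]
        congr 2
        refine tsum_congr fun k => ?_
        by_cases h : ‖y‖ / l ≤ 2 ^ k
        · have : y ∈ Metric.closedBall (0 : E n) (2 ^ k * l) := by
            rwa [mem_closedBall_zero_iff, ← div_le_iff₀ hl]
          rw [if_pos h, Set.indicator_of_mem this, Pi.one_apply, mul_one]
        · have : y ∉ Metric.closedBall (0 : E n) (2 ^ k * l) := by
            rwa [mem_closedBall_zero_iff, ← div_le_iff₀ hl]
          rw [if_neg h, Set.indicator_of_notMem this, mul_zero]

theorem lpOp_eq_integral_sub {ψ : 𝓢(E n, ℂ)} (hψ : IsLittlewoodPaley ψ) (j : ℤ)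
    {f : E n → ℂ} (hf : MemLp f 2) (x : E n) :
    lpOp ψ j f x = ∫ t, dilate ψ j t * (f (x - t) - f x) := by
  have h0 : ∫ t, dilate ψ j t = 0 := by
    have h := fourier_dilate ψ j 0
    rw [smul_zero, fourier_zero_eq_zero hψ, Real.fourier_eq'] at h
    simpa using h
  simp_rw [mul_sub]
  rw [integral_sub (integrable_dilate_mul ψ j hf x) ((integrable_dilate ψ j).mul_const _),
    integral_mul_const, h0, zero_mul, sub_zero, lpOp_apply]

/-- The integrand of the `qNorm`, as a function of a point and an increment, cut off to
increments of norm at most `r`. -/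
noncomputable def truncDiff (a r : ℝ) (f : E n → ℂ) (x t : E n) : ℝ≥0∞ :=
  (Metric.closedBall (0 : E n) r).indicator 1 t *
    (‖f (x - t) - f x‖ₑ ^ 2 / ENNReal.ofReal (‖t‖ ^ a))

theorem measurable_enorm_diff_sq {f : E n → ℂ} (hf : Measurable f) :
    Measurable fun p : E n × E n => ‖f (p.1 - p.2) - f p.1‖ₑ ^ 2 :=
  ((hf.comp (measurable_fst.sub measurable_snd)).sub (hf.comp measurable_fst)).enorm.pow_const 2

theorem measurable_truncDiff (a r : ℝ) {f : E n → ℂ} (hf : Measurable f) :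
    Measurable (Function.uncurry (truncDiff a r f)) := by
  have h1 : Measurable fun t : E n => ENNReal.ofReal (‖t‖ ^ a) :=
    (measurable_norm.pow_const a).ennreal_ofReal
  exact ((measurable_one.indicator Metric.isClosed_closedBall.measurableSet).comp
    measurable_snd).mul ((measurable_enorm_diff_sq hf).div (h1.comp measurable_snd))

/-- Substituting y = x - t keeps y in the cube expanded by r. -/
theorem lintegral_truncDiff_le {a r : ℝ} (hr : 0 ≤ r) (f : E n → ℂ) (I : Cube n) :
    ∫⁻ x in I.toSet, ∫⁻ t, truncDiff a r f x t ≤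
      ∫⁻ x in (I.expand r hr).toSet, ∫⁻ y in (I.expand r hr).toSet,
        ‖f x - f y‖ₑ ^ 2 / ENNReal.ofReal (‖x - y‖ ^ a) := by
  refine le_trans ?_ (lintegral_mono_set (Cube.subset_expand hr))
  refine setLIntegral_mono' I.measurableSet_toSet fun x hx => ?_
  rw [← lintegral_sub_left_eq_self _ x, ← lintegral_indicator (Cube.measurableSet_toSet _)]
  refine lintegral_mono fun y => ?_
  rw [truncDiff]
  by_cases hy : ‖x - y‖ ≤ r
  · rw [Set.indicator_of_mem (by simpa using hy),
      Set.indicator_of_mem (Cube.mem_expand hr hx hy), Pi.one_apply, one_mul, sub_sub_cancel,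
      ← enorm_neg, neg_sub]
  · rw [Set.indicator_of_notMem (by simpa using hy), zero_mul]
    exact zero_le

theorem lintegral_tsum_const_mul {X ι : Type*} [Countable ι] [MeasurableSpace X] {μ : Measure X}
    {c : ι → ℝ≥0∞} (hc : ∀ i, c i ≠ ∞) {F : ι → X → ℝ≥0∞} (hF : ∀ i, Measurable (F i)) :
    ∫⁻ x, ∑' i, c i * F i x ∂μ = ∑' i, c i * ∫⁻ x, F i x ∂μ := by
  rw [lintegral_tsum fun i => ((hF i).const_mul _).aemeasurable]
  exact tsum_congr fun i => lintegral_const_mul' _ _ (hc i)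

/-- The pointwise form of this direction: mean zero, Cauchy-Schwarz against ψ_j, then the kernel sum
of `tsum_decayKernel_le`. -/
theorem exists_tsum_lpOp_sq_le {α : ℝ} (hα : 0 < α) {M : ℝ} (hM : n < M) {ψ : 𝓢(E n, ℂ)}
    (hψ : IsLittlewoodPaley ψ) : ∃ C : ℝ≥0, ∀ f : E n → ℂ, Measurable f → MemLp f 2 →
      ∀ (l : ℝ), 0 < l → ∀ x : E n, ∑' j : {j : ℤ // 1 ≤ (2 : ℝ) ^ j * l},
        ENNReal.ofReal (((2 : ℝ) ^ (j : ℤ)) ^ (2 * α)) * ‖lpOp ψ j f x‖ₑ ^ 2 ≤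
      C * ∑' k : ℕ, ENNReal.ofReal ((2 : ℝ) ^ (-M * k)) *
        ∫⁻ t, truncDiff (2 * α + n) (2 ^ k * l) f x t := by
  have hn0 : (0 : ℝ) ≤ n := Nat.cast_nonneg n
  obtain ⟨C₁, h₁⟩ := exists_enorm_integral_dilate_mul_sq_le ψ
    (N := 2 * (2 * α + n) + M) (by linarith)
  obtain ⟨C₂, h₂⟩ := tsum_decayKernel_le (n := n) hα M (by linarith)
  refine ⟨C₁ * C₂, fun f hfm hf l hl x => ?_⟩
  have hDx : Measurable fun t => ‖f (x - t) - f x‖ₑ ^ 2 :=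
    ((hfm.comp (measurable_const.sub measurable_id)).sub_const _).enorm.pow_const 2
  have hK : ∀ j : ℤ, Measurable fun t =>
      decayKernel (2 * (2 * α + n) + M) (2 ^ j) t * ‖f (x - t) - f x‖ₑ ^ 2 := fun j =>
    (measurable_decayKernel (by positivity)).mul hDx
  calc _ ≤ ∑' j : {j : ℤ // 1 ≤ (2 : ℝ) ^ j * l}, ENNReal.ofReal (((2 : ℝ) ^ (j : ℤ)) ^ (2 * α)) *
        (C₁ * ∫⁻ t, decayKernel (2 * (2 * α + n) + M) (2 ^ (j : ℤ)) t *
          ‖f (x - t) - f x‖ₑ ^ 2) := by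
        refine ENNReal.tsum_le_tsum fun j => ?_
        rw [lpOp_eq_integral_sub hψ j hf x]
        gcongr
        exact h₁ j (fun t => f (x - t) - f x)
          ((hfm.comp (measurable_const.sub measurable_id)).sub_const _)
    _ = C₁ * ∫⁻ t, (∑' j : {j : ℤ // 1 ≤ (2 : ℝ) ^ j * l},
          ENNReal.ofReal (((2 : ℝ) ^ (j : ℤ)) ^ (2 * α)) *
          decayKernel (2 * (2 * α + n) + M) (2 ^ (j : ℤ)) t) * ‖f (x - t) - f x‖ₑ ^ 2 := by
        simp_rw [← ENNReal.tsum_mul_right, mul_assoc]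
        rw [lintegral_tsum_const_mul (fun j => ENNReal.ofReal_ne_top) fun j :
          {j : ℤ // 1 ≤ (2 : ℝ) ^ j * l} => hK j, ← ENNReal.tsum_mul_left]
        exact tsum_congr fun j => mul_left_comm _ _ _
    _ ≤ C₁ * ∫⁻ t, C₂ * ∑' k : ℕ, ENNReal.ofReal ((2 : ℝ) ^ (-M * k)) *
          truncDiff (2 * α + n) (2 ^ k * l) f x t := by
        refine mul_le_mul_right (lintegral_mono fun t => ?_) _
        rcases eq_or_ne t 0 with rfl | ht
        · simp
        refine (mul_le_mul_left (h₂ _ hl t ht) _).trans (le_of_eq ?_)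
        rw [mul_assoc, mul_assoc, ← ENNReal.tsum_mul_right, ← ENNReal.tsum_mul_left]
        congr 1
        refine tsum_congr fun k => ?_
        have ht' : 0 < ‖t‖ := norm_pos_iff.2 ht
        rw [Real.rpow_neg ht'.le, ENNReal.ofReal_inv_of_pos (by positivity), truncDiff]
        simp only [div_eq_mul_inv]
        ring
    _ = _ := by
        rw [lintegral_const_mul' _ _ ENNReal.coe_ne_top, ← mul_assoc, ENNReal.coe_mul]
        congr 1
        exact lintegral_tsum_const_mul (fun k => ENNReal.ofReal_ne_top)
          fun k : ℕ => (measurable_truncDiff _ (2 ^ k * l) hfm).of_uncurry_left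

theorem exists_lpSq_le_qSq {α : ℝ} (hα : 0 < α) {ψ : 𝓢(E n, ℂ)}
    (hψ : IsLittlewoodPaley ψ) : ∃ C : ℝ≥0, ∀ f : E n → ℂ, Measurable f → MemLp f 2 →
      lpSq ψ α f ≤ C * qSq α f := by
  -- Tail order n+1 beats the growth 2^(nk) of the enlarged cubes and leaves the series ∑ 2^(-k).
  obtain ⟨C, hC⟩ := exists_tsum_lpOp_sq_le (M := n + 1) hα (by linarith) hψ
  have hSfin : ENNReal.ofReal (3 ^ n) * ∑' k : ℕ, ENNReal.ofReal ((2 : ℝ) ^ (-1 * (k : ℝ))) < ∞ :=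
    ENNReal.mul_lt_top ENNReal.ofReal_lt_top (tsum_geometric_ofReal_lt_top one_pos)
  refine ⟨C * (ENNReal.ofReal (3 ^ n) *
    ∑' k : ℕ, ENNReal.ofReal ((2 : ℝ) ^ (-1 * (k : ℝ)))).toNNReal,
    fun f hfm hf => iSup_le fun I => ?_⟩
  rw [← neg_sub (n : ℝ)]
  refine ofReal_rpow_neg_mul_le I.side_pos ?_
  have hl := I.side_pos
  have hr : ∀ k : ℕ, 0 ≤ 2 ^ k * I.side := fun k => by positivity
  rw [ENNReal.coe_mul, ENNReal.coe_toNNReal hSfin.ne]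
  calc _ = ∫⁻ x in I.toSet, ∑' j : {j : ℤ // 1 ≤ (2 : ℝ) ^ j * I.side},
        ENNReal.ofReal (((2 : ℝ) ^ (j : ℤ)) ^ (2 * α)) * ‖lpOp ψ j f x‖ₑ ^ 2 := by
        exact (lintegral_tsum_const_mul (fun j => ENNReal.ofReal_ne_top)
          fun j : {j : ℤ // 1 ≤ (2 : ℝ) ^ j * I.side} =>
            (measurable_lpOp ψ j hfm).enorm.pow_const 2).symm
    _ ≤ ∫⁻ x in I.toSet, C * ∑' k : ℕ, ENNReal.ofReal ((2 : ℝ) ^ (-(n + 1 : ℝ) * k)) *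
        ∫⁻ t, truncDiff (2 * α + n) (2 ^ k * I.side) f x t :=
        lintegral_mono (hC f hfm hf _ hl)
    _ = C * ∑' k : ℕ, ENNReal.ofReal ((2 : ℝ) ^ (-(n + 1 : ℝ) * k)) *
        ∫⁻ x in I.toSet, ∫⁻ t, truncDiff (2 * α + n) (2 ^ k * I.side) f x t := by
        rw [lintegral_const_mul' _ _ ENNReal.coe_ne_top]
        congr 1
        exact lintegral_tsum_const_mul (fun k => ENNReal.ofReal_ne_top)
          fun k : ℕ => (measurable_truncDiff _ (2 ^ k * I.side) hfm).lintegral_prod_right'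
    _ ≤ C * ∑' k : ℕ, ENNReal.ofReal ((2 : ℝ) ^ (-(n + 1 : ℝ) * k)) *
          (ENNReal.ofReal (3 ^ n * 2 ^ ((n : ℝ) * k)) *
            (ENNReal.ofReal (I.side ^ ((n : ℝ) - 2 * α)) * qSq α f)) := by
        gcongr with k
        exact (lintegral_truncDiff_le (hr k) f I).trans
          (lintegral_dyadic_expand_le_qSq hα f I k (hr k))
    _ = _ := by
        rw [mul_assoc (C : ℝ≥0∞), mul_left_comm (ENNReal.ofReal _) (C : ℝ≥0∞)]
        congr 1
        rw [mul_left_comm, mul_assoc (ENNReal.ofReal (3 ^ n)), ← ENNReal.tsum_mul_right, ← ENNReal.tsum_mul_left]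
        refine tsum_congr fun k => ?_
        rw [ENNReal.ofReal_mul (by positivity),
          show -1 * (k : ℝ) = -(n + 1 : ℝ) * k + n * k by ring, ← ofReal_two_rpow_mul]
        ring

/-! ### Averages of Δ_j f -/

/-- The average of `‖Δ_j f‖` at scale `2^(-j)` around a point. -/
noncomputable def lpAvg (ψ : 𝓢(E n, ℂ)) (N : ℝ) (j : ℤ) (f : E n → ℂ) (x : E n) : ℝ≥0∞ :=
  ∫⁻ z, decayKernel N (2 ^ j) (x - z) * ‖lpOp ψ j f z‖ₑ

theorem measurable_lpAvg (ψ : 𝓢(E n, ℂ)) (N : ℝ) (j : ℤ) {f : E n → ℂ} (hf : Measurable f) :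
    Measurable (lpAvg ψ N j f) := by
  have : Measurable fun p : E n × E n =>
      decayKernel N (2 ^ j) (p.1 - p.2) * ‖lpOp ψ j f p.2‖ₑ :=
    ((measurable_decayKernel (by positivity)).comp (measurable_fst.sub measurable_snd)).mul
      ((measurable_lpOp ψ j hf).comp measurable_snd).enorm
  exact this.lintegral_prod_right'

/-- By the reproducing formula the difference is an integral of φ_j(x-z) - φ_j(y-z) against Δ_j
f(z), so smoothness of φ yields the gain min(1, 2^j‖x-y‖). -/
theorem exists_enorm_lpOp_sub_le {ψ : 𝓢(E n, ℂ)} (hψ : IsLittlewoodPaley ψ) {N : ℝ}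
    (hN : 0 ≤ N) : ∃ C : ℝ≥0, ∀ f : E n → ℂ, Measurable f → MemLp f 2 → ∀ (j : ℤ) (x y : E n),
      ‖lpOp ψ j f x - lpOp ψ j f y‖ₑ ≤ C * (ENNReal.ofReal (min 1 (2 ^ j * ‖x - y‖)) *
        (lpAvg ψ N j f x + lpAvg ψ N j f y)) := by
  obtain ⟨φ, hφ⟩ := exists_fourier_eq_one_on_ball n
  obtain ⟨C, hC⟩ := exists_enorm_dilate_sub_le φ hN
  refine ⟨C, fun f hfm hf j x y => ?_⟩
  set g := lpOp ψ j f with hg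
  have hgL : MemLp g 2 := memLp_lpOp ψ j hfm hf
  have hgm : Measurable g := measurable_lpOp ψ j hfm
  have hint : ∀ x, Integrable fun z => dilate φ j (x - z) * g z := fun x => by
    have := (integrable_dilate_mul φ j hgL x).comp_sub_left x
    simpa using this
  have hrep : ∀ x, g x = ∫ z, dilate φ j (x - z) * g z := fun x => by
    rw [← lpOp_apply_swap, hg, lpOp_lpOp_eq ψ φ j hψ.tsupport_fourier_subset hφ hfm hf]
  have hk : ∀ x, Measurable fun z => decayKernel N (2 ^ j) (x - z) * ‖g z‖ₑ := fun x =>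
    ((measurable_decayKernel (by positivity)).comp (measurable_const.sub measurable_id)).mul
      hgm.enorm
  calc ‖g x - g y‖ₑ = ‖∫ z, (dilate φ j (x - z) - dilate φ j (y - z)) * g z‖ₑ := by
        rw [hrep x, hrep y, ← integral_sub (hint x) (hint y)]
        simp_rw [sub_mul]
    _ ≤ ∫⁻ z, ‖(dilate φ j (x - z) - dilate φ j (y - z)) * g z‖ₑ :=
        enorm_integral_le_lintegral_enorm _
    _ ≤ ∫⁻ z, C * ENNReal.ofReal (min 1 (2 ^ j * ‖x - y‖)) *
          (decayKernel N (2 ^ j) (x - z) * ‖g z‖ₑ + decayKernel N (2 ^ j) (y - z) * ‖g z‖ₑ) := by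
        refine lintegral_mono fun z => ?_
        rw [enorm_mul, ← add_mul, ← mul_assoc]
        gcongr
        have := hC j (x - z) (y - z)
        rwa [sub_sub_sub_cancel_right] at this
    _ = _ := by
        rw [lintegral_const_mul' _ _ (by finiteness), lintegral_add_left (hk x), mul_assoc]
        rfl

theorem exists_lpAvg_sq_le (ψ : 𝓢(E n, ℂ)) {N : ℝ} (hN : n < N) :
    ∃ C : ℝ≥0, ∀ f : E n → ℂ, Measurable f → ∀ (j : ℤ) (x : E n),
      lpAvg ψ N j f x ^ 2 ≤ C * ∑' k : ℕ, ENNReal.ofReal ((2 : ℝ) ^ (-N * k)) *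
        (ENNReal.ofReal (((2 : ℝ) ^ j) ^ n) *
          ∫⁻ z in Metric.closedBall x (2 ^ k / 2 ^ j), ‖lpOp ψ j f z‖ₑ ^ 2) := by
  obtain ⟨C, hC⟩ := lintegral_decayKernel_le hN
  have hN0 : 0 ≤ N := (Nat.cast_nonneg n).trans hN.le
  refine ⟨C * Real.toNNReal (2 ^ N), fun f hfm j x => ?_⟩
  have hl : (0 : ℝ) < 2 ^ j := by positivity
  have hgm := measurable_lpOp ψ j hfm
  have hk : Measurable fun z : E n => decayKernel N (2 ^ j) (x - z) :=
    (measurable_decayKernel hl.le).comp (measurable_const.sub measurable_id)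
  have hcb : ∀ k : ℕ, MeasurableSet (Metric.closedBall x (2 ^ k / 2 ^ j)) := fun k =>
    Metric.isClosed_closedBall.measurableSet
  calc _ ≤ (∫⁻ z, decayKernel N (2 ^ j) (x - z)) *
        ∫⁻ z, decayKernel N (2 ^ j) (x - z) * ‖lpOp ψ j f z‖ₑ ^ 2 :=
        sq_lintegral_mul_le hk.aemeasurable hgm.enorm.aemeasurable
    _ ≤ C * ∫⁻ z, ∑' k : ℕ, (ENNReal.ofReal (2 ^ N) * ENNReal.ofReal ((2 : ℝ) ^ (-N * k)) *
          ENNReal.ofReal (((2 : ℝ) ^ j) ^ n)) *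
          (Metric.closedBall x (2 ^ k / 2 ^ j)).indicator (fun z => ‖lpOp ψ j f z‖ₑ ^ 2) z := by
        gcongr ?_ * ?_
        · rw [lintegral_sub_left_eq_self (decayKernel N (2 ^ j)) x]
          exact hC _ hl
        · refine lintegral_mono fun z => ?_
          refine (mul_le_mul_left (decayKernel_le hN0 hl _) _).trans (le_of_eq ?_)
          rw [← ENNReal.tsum_mul_right]
          refine tsum_congr fun k => ?_
          rw [mul_assoc]
          congr 1
          by_cases h : z ∈ Metric.closedBall x (2 ^ k / 2 ^ j)
          · have : x - z ∈ Metric.closedBall (0 : E n) (2 ^ k / 2 ^ j) := by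
              rwa [mem_closedBall_zero_iff, ← mem_closedBall_iff_norm']
            rw [Set.indicator_of_mem this, Set.indicator_of_mem h, Pi.one_apply, one_mul]
          · have : x - z ∉ Metric.closedBall (0 : E n) (2 ^ k / 2 ^ j) := by
              rwa [mem_closedBall_zero_iff, ← mem_closedBall_iff_norm']
            rw [Set.indicator_of_notMem this, Set.indicator_of_notMem h, zero_mul]
    _ = _ := by
        have hg2 : Measurable fun z => ‖lpOp ψ j f z‖ₑ ^ 2 := hgm.enorm.pow_const 2
        rw [lintegral_tsum_const_mul (fun k => ENNReal.mul_ne_top (ENNReal.mul_ne_top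
          ENNReal.ofReal_ne_top ENNReal.ofReal_ne_top) ENNReal.ofReal_ne_top) fun k => hg2.indicator (hcb k),
          ENNReal.coe_mul, mul_assoc, ← ENNReal.ofReal.eq_1,
          ← ENNReal.tsum_mul_left (a := ENNReal.ofReal (2 ^ N))]
        congr 1
        refine tsum_congr fun k => ?_
        rw [lintegral_indicator (hcb k), mul_assoc, mul_assoc]

theorem lintegral_cube_lpOp_le (ψ : 𝓢(E n, ℂ)) (α : ℝ) (f : E n → ℂ) (I : Cube n) (j : ℤ)
    (hj : 1 ≤ (2 : ℝ) ^ j * I.side) :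
    ENNReal.ofReal (((2 : ℝ) ^ j) ^ (2 * α)) * ∫⁻ x in I.toSet, ‖lpOp ψ j f x‖ₑ ^ 2 ≤
      ENNReal.ofReal (I.side ^ ((n : ℝ) - 2 * α)) * lpSq ψ α f :=
  (ENNReal.le_tsum (⟨j, hj⟩ : {j : ℤ // 1 ≤ (2 : ℝ) ^ j * I.side})).trans
    (tsum_cube_le_lpSq ψ α f I)

/-- The ball lies in a cube of side 2·2^k·2^(-j), large enough for j to be admissible; all powers of
2^j then cancel. -/
theorem lintegral_closedBall_lpOp_le (ψ : 𝓢(E n, ℂ)) {α : ℝ} (hα : 0 < α) (f : E n → ℂ)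
    (j : ℤ) (k : ℕ) (x : E n) :
    ENNReal.ofReal (((2 : ℝ) ^ j) ^ n) *
      ∫⁻ z in Metric.closedBall x (2 ^ k / 2 ^ j), ‖lpOp ψ j f z‖ₑ ^ 2 ≤
      ENNReal.ofReal (2 ^ n * 2 ^ ((n : ℝ) * k)) * lpSq ψ α f := by
  have hl : (0 : ℝ) < 2 ^ j := by positivity
  have hr : (0 : ℝ) < 2 ^ k / 2 ^ j := by positivity
  have hk : (1 : ℝ) ≤ 2 ^ k := one_le_pow₀ (by norm_num)
  set I := Cube.centered x _ hr with hI
  have hside : I.side = (2 ^ j)⁻¹ * (2 * 2 ^ k) := by simp only [hI, Cube.centered]; ring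
  have h1 := lintegral_cube_lpOp_le ψ α f I j (by
    rw [hside, mul_inv_cancel_left₀ hl.ne']; linarith)
  calc _ ≤ ENNReal.ofReal (((2 : ℝ) ^ j) ^ n) * ∫⁻ z in I.toSet, ‖lpOp ψ j f z‖ₑ ^ 2 := by
        gcongr
        exact Cube.closedBall_subset_centered x _ hr
    _ = ENNReal.ofReal (((2 : ℝ) ^ j) ^ ((n : ℝ) - 2 * α)) *
          (ENNReal.ofReal (((2 : ℝ) ^ j) ^ (2 * α)) *
            ∫⁻ z in I.toSet, ‖lpOp ψ j f z‖ₑ ^ 2) := by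
        rw [← mul_assoc, ← ENNReal.ofReal_mul (by positivity), ← Real.rpow_add hl, sub_add_cancel,
          Real.rpow_natCast]
    _ ≤ ENNReal.ofReal (((2 : ℝ) ^ j) ^ ((n : ℝ) - 2 * α)) *
          (ENNReal.ofReal (I.side ^ ((n : ℝ) - 2 * α)) * lpSq ψ α f) := by gcongr
    _ ≤ _ := by
        rw [← mul_assoc, ← ENNReal.ofReal_mul (by positivity)]
        refine mul_le_mul_left (ENNReal.ofReal_le_ofReal ?_) _
        rw [hside]
        refine (mul_le_mul_of_nonneg_left
          (mul_rpow_sub_le (l := (2 ^ j)⁻¹) (s := 2 * 2 ^ k) (by positivity) (by linarith) hα)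
          (by positivity)).trans (le_of_eq ?_)
        rw [← mul_assoc, ← Real.mul_rpow hl.le (by positivity), mul_inv_cancel₀ hl.ne',
          Real.one_rpow, one_mul, mul_pow, mul_comm (n : ℝ), Real.rpow_mul (by norm_num),
          Real.rpow_natCast, Real.rpow_natCast]

/-- Uniform in j and x, this replaces the missing information about frequencies below the scale of a
given cube. -/
theorem exists_lpAvg_sq_le_lpSq (ψ : 𝓢(E n, ℂ)) {α : ℝ} (hα : 0 < α) {N : ℝ} (hN : n < N) :
    ∃ C : ℝ≥0, ∀ f : E n → ℂ, Measurable f → ∀ (j : ℤ) (x : E n),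
      lpAvg ψ N j f x ^ 2 ≤ C * lpSq ψ α f := by
  obtain ⟨C, hC⟩ := exists_lpAvg_sq_le ψ hN
  have hS : ENNReal.ofReal (2 ^ n) * ∑' k : ℕ, ENNReal.ofReal ((2 : ℝ) ^ (-(N - n) * k)) < ∞ :=
    ENNReal.mul_lt_top ENNReal.ofReal_lt_top (tsum_geometric_ofReal_lt_top (sub_pos.2 hN))
  refine ⟨C * (ENNReal.ofReal (2 ^ n) *
    ∑' k : ℕ, ENNReal.ofReal ((2 : ℝ) ^ (-(N - n) * k))).toNNReal, fun f hfm j x => ?_⟩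
  refine (hC f hfm j x).trans ?_
  rw [ENNReal.coe_mul, ENNReal.coe_toNNReal hS.ne, mul_assoc,
    ← ENNReal.tsum_mul_left (a := ENNReal.ofReal (2 ^ n)), ← ENNReal.tsum_mul_right]
  refine mul_le_mul_right (ENNReal.tsum_le_tsum fun k => ?_) _
  refine (mul_le_mul_right (lintegral_closedBall_lpOp_le ψ hα f j k x) _).trans (le_of_eq ?_)
  rw [ENNReal.ofReal_mul (by positivity), show -(N - n) * (k : ℝ) = -N * k + n * k by ring,
    ← ofReal_two_rpow_mul]
  ring

/-- By Tonelli each z is counted with the volume of the ball of radius r about it. -/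
theorem lintegral_lintegral_closedBall_le {h : E n → ℝ≥0∞} (hh : Measurable h) (I : Cube n)
    {r R : ℝ} (hR : 0 ≤ R) (hrR : r ≤ R) {A : ℝ≥0∞}
    (hA : ∀ x : E n, volume (Metric.closedBall x r) ≤ A) :
    ∫⁻ x in I.toSet, ∫⁻ z in Metric.closedBall x r, h z ≤
      A * ∫⁻ z in (I.expand R hR).toSet, h z := by
  have hm : MeasurableSet {p : E n × E n | ‖p.1 - p.2‖ ≤ r} :=
    measurableSet_le (measurable_fst.sub measurable_snd).norm measurable_const
  set F : E n × E n → ℝ≥0∞ := fun p => {p : E n × E n | ‖p.1 - p.2‖ ≤ r}.indicator 1 p *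
    (I.expand R hR).toSet.indicator h p.2 with hF
  have hFm : Measurable F := (measurable_one.indicator hm).mul
    ((hh.indicator (Cube.measurableSet_toSet _)).comp measurable_snd)
  calc _ ≤ ∫⁻ x in I.toSet, ∫⁻ z, F (x, z) := by
        refine setLIntegral_mono' I.measurableSet_toSet fun x hx => ?_
        rw [← lintegral_indicator Metric.isClosed_closedBall.measurableSet]
        refine lintegral_mono fun z => ?_
        by_cases hz : z ∈ Metric.closedBall x r
        · have h1 : ‖x - z‖ ≤ r := by rwa [← mem_closedBall_iff_norm']
          rw [Set.indicator_of_mem hz, hF]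
          simp only
          rw [Set.indicator_of_mem (by exact h1),
            Set.indicator_of_mem (Cube.mem_expand hR hx (h1.trans hrR)), Pi.one_apply, one_mul]
        · rw [Set.indicator_of_notMem hz]
          exact zero_le
    _ ≤ ∫⁻ x, ∫⁻ z, F (x, z) := setLIntegral_le_lintegral _ _
    _ = ∫⁻ z, ∫⁻ x, F (x, z) := lintegral_lintegral_swap hFm.aemeasurable
    _ ≤ ∫⁻ z, A * (I.expand R hR).toSet.indicator h z := by
        refine lintegral_mono fun z => ?_
        have hmz : Measurable fun x : E n =>
            {p : E n × E n | ‖p.1 - p.2‖ ≤ r}.indicator (1 : E n × E n → ℝ≥0∞) (x, z) :=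
          (measurable_one.indicator hm).comp (measurable_id.prodMk measurable_const)
        simp only [hF]
        rw [lintegral_mul_const _ hmz]
        gcongr
        refine le_trans (le_of_eq ?_) (hA z)
        rw [← lintegral_indicator_one Metric.isClosed_closedBall.measurableSet]
        refine lintegral_congr fun x => ?_
        simp only [Set.indicator, Set.mem_ofPred_eq, mem_closedBall_iff_norm, Pi.one_apply]
    _ = _ := by
        rw [lintegral_const_mul _ (hh.indicator (Cube.measurableSet_toSet _)),
          lintegral_indicator (Cube.measurableSet_toSet _)]

theorem tsum_dyadic_expand_le_lpSq {α : ℝ} (hα : 0 < α) (ψ : 𝓢(E n, ℂ)) (f : E n → ℂ)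
    (I : Cube n) (k : ℕ) (hr : 0 ≤ 2 ^ k * I.side) :
    ∑' j : {j : ℤ // 1 ≤ (2 : ℝ) ^ j * I.side}, ENNReal.ofReal (((2 : ℝ) ^ (j : ℤ)) ^ (2 * α)) *
      ∫⁻ x in (I.expand _ hr).toSet, ‖lpOp ψ j f x‖ₑ ^ 2 ≤
      ENNReal.ofReal (3 ^ n * 2 ^ ((n : ℝ) * k)) *
        (ENNReal.ofReal (I.side ^ ((n : ℝ) - 2 * α)) * lpSq ψ α f) := by
  have hl := I.side_pos
  have h1 : (1 : ℝ) ≤ 2 ^ k := one_le_pow₀ (by norm_num)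
  have hs : (I.expand _ hr).side = I.side * (1 + 2 * 2 ^ k) := by simp only [Cube.expand]; ring
  have hle : ∀ j : ℤ, 1 ≤ (2 : ℝ) ^ j * I.side → 1 ≤ (2 : ℝ) ^ j * (I.expand _ hr).side := by
    intro j hj
    rw [hs, ← mul_assoc]
    nlinarith
  let ι : {j : ℤ // 1 ≤ (2 : ℝ) ^ j * I.side} →
    {j : ℤ // 1 ≤ (2 : ℝ) ^ j * (I.expand _ hr).side} := fun j => ⟨j.1, hle j.1 j.2⟩
  have hι : Function.Injective ι := fun a b hab =>
    by simpa [ι, Subtype.ext_iff] using hab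
  refine (ENNReal.tsum_comp_le_tsum_of_injective hι (fun j => ENNReal.ofReal
    (((2 : ℝ) ^ (j : ℤ)) ^ (2 * α)) *
      ∫⁻ x in (I.expand _ hr).toSet, ‖lpOp ψ j f x‖ₑ ^ 2)).trans ?_
  refine (tsum_cube_le_lpSq ψ α f _).trans ?_
  rw [← mul_assoc, ← ENNReal.ofReal_mul (by positivity)]
  gcongr
  rw [hs, mul_comm _ (I.side ^ _)]
  refine (mul_rpow_sub_le hl (by linarith) hα).trans ?_
  gcongr
  rw [mul_comm (n : ℝ), Real.rpow_mul (by norm_num), Real.rpow_natCast, Real.rpow_natCast,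
    ← mul_pow]
  gcongr
  linarith

/-- The high-frequency estimate. Each k costs 2^(nk) twice, once for the volume of the averaging
ball and once for the enlarged cube, whence N > 2n. -/
theorem exists_tsum_lintegral_lpAvg_sq_le (ψ : 𝓢(E n, ℂ)) {α : ℝ} (hα : 0 < α) {N : ℝ}
    (hN : 2 * n < N) : ∃ C : ℝ≥0, ∀ f : E n → ℂ, Measurable f → ∀ I : Cube n,
      ∑' j : {j : ℤ // 1 ≤ (2 : ℝ) ^ j * I.side}, ENNReal.ofReal (((2 : ℝ) ^ (j : ℤ)) ^ (2 * α)) *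
        ∫⁻ x in I.toSet, lpAvg ψ N j f x ^ 2 ≤
      C * (ENNReal.ofReal (I.side ^ ((n : ℝ) - 2 * α)) * lpSq ψ α f) := by
  have hn0 : (0 : ℝ) ≤ n := Nat.cast_nonneg n
  obtain ⟨C₁, h₁⟩ := exists_lpAvg_sq_le ψ (N := N) (by linarith)
  obtain ⟨C₂, h₂⟩ := ofReal_pow_mul_volume_closedBall_le n
  have hS : ENNReal.ofReal (3 ^ n) * ∑' k : ℕ, ENNReal.ofReal ((2 : ℝ) ^ (-(N - 2 * n) * k)) < ∞ :=
    ENNReal.mul_lt_top ENNReal.ofReal_lt_top (tsum_geometric_ofReal_lt_top (sub_pos.2 hN))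
  refine ⟨C₁ * C₂ * (ENNReal.ofReal (3 ^ n) *
    ∑' k : ℕ, ENNReal.ofReal ((2 : ℝ) ^ (-(N - 2 * n) * k))).toNNReal, fun f hfm I => ?_⟩
  have hl := I.side_pos
  have hr : ∀ k : ℕ, 0 ≤ 2 ^ k * I.side := fun k => by positivity
  have hgm : ∀ j : ℤ, Measurable fun z => ‖lpOp ψ j f z‖ₑ ^ 2 := fun j =>
    (measurable_lpOp ψ j hfm).enorm.pow_const 2
  have hsingle : ∀ j : {j : ℤ // 1 ≤ (2 : ℝ) ^ j * I.side},
      ∫⁻ x in I.toSet, lpAvg ψ N j f x ^ 2 ≤ C₁ * ∑' k : ℕ,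
        ENNReal.ofReal ((2 : ℝ) ^ (-N * k)) * (C₂ * ENNReal.ofReal (2 ^ ((n : ℝ) * k)) *
          ∫⁻ z in (I.expand _ (hr k)).toSet, ‖lpOp ψ j f z‖ₑ ^ 2) := by
    rintro ⟨j, hj⟩
    have hj0 : (0 : ℝ) < 2 ^ j := by positivity
    have hjn : ENNReal.ofReal (((2 : ℝ) ^ j) ^ n) ≠ 0 := by
      rw [ne_eq, ENNReal.ofReal_eq_zero, not_le]; positivity
    have hmm : ∀ k : ℕ, Measurable fun x : E n =>
        ∫⁻ z in Metric.closedBall x (2 ^ k / 2 ^ j), ‖lpOp ψ j f z‖ₑ ^ 2 := fun k => by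
      have hm : MeasurableSet {p : E n × E n | ‖p.2 - p.1‖ ≤ 2 ^ k / 2 ^ j} :=
        measurableSet_le (measurable_snd.sub measurable_fst).norm measurable_const
      have := (((hgm j).comp measurable_snd).indicator hm).lintegral_prod_right' (ν := volume)
      convert this using 2 with x
      rw [← lintegral_indicator Metric.isClosed_closedBall.measurableSet]
      refine lintegral_congr fun z => ?_
      simp only [Set.indicator, Set.mem_ofPred_eq, mem_closedBall_iff_norm, Function.comp]
    calc _ ≤ ∫⁻ x in I.toSet, C₁ * ∑' k : ℕ, ENNReal.ofReal ((2 : ℝ) ^ (-N * k)) *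
          (ENNReal.ofReal (((2 : ℝ) ^ j) ^ n) *
            ∫⁻ z in Metric.closedBall x (2 ^ k / 2 ^ j), ‖lpOp ψ j f z‖ₑ ^ 2) :=
          lintegral_mono fun x => h₁ f hfm j x
      _ = C₁ * ∑' k : ℕ, ENNReal.ofReal ((2 : ℝ) ^ (-N * k)) *
          (ENNReal.ofReal (((2 : ℝ) ^ j) ^ n) * ∫⁻ x in I.toSet,
            ∫⁻ z in Metric.closedBall x (2 ^ k / 2 ^ j), ‖lpOp ψ j f z‖ₑ ^ 2) := by
          rw [lintegral_const_mul' _ _ ENNReal.coe_ne_top]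
          congr 1
          rw [lintegral_tsum_const_mul (fun k => ENNReal.ofReal_ne_top)
            fun k => (hmm k).const_mul _]
          refine tsum_congr fun k => ?_
          rw [lintegral_const_mul' _ _ ENNReal.ofReal_ne_top]
      _ ≤ _ := by
          gcongr _ * ?_
          refine ENNReal.tsum_le_tsum fun k => ?_
          gcongr _ * ?_
          have hle : (2 : ℝ) ^ k / 2 ^ j ≤ 2 ^ k * I.side := by
            rw [div_le_iff₀ hj0]
            nlinarith [show (0 : ℝ) < 2 ^ k by positivity]
          -- The denominator in A is the normalization 2^(jn), which cancels the same factor in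
          -- front of the ball average.
          have := lintegral_lintegral_closedBall_le (hgm j) I (hr k) hle
            (A := C₂ * ENNReal.ofReal (2 ^ ((n : ℝ) * k)) / ENNReal.ofReal (((2 : ℝ) ^ j) ^ n))
            (fun x => by
              rw [ENNReal.le_div_iff_mul_le (Or.inl hjn) (Or.inl ENNReal.ofReal_ne_top), mul_comm]
              exact h₂ x k _ hj0)
          refine (mul_le_mul_right this _).trans (le_of_eq ?_)
          rw [← mul_assoc, ENNReal.mul_div_cancel hjn ENNReal.ofReal_ne_top]
  calc _ ≤ ∑' j : {j : ℤ // 1 ≤ (2 : ℝ) ^ j * I.side}, ∑' k : ℕ, C₁ * C₂ *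
        (ENNReal.ofReal ((2 : ℝ) ^ (-N * k)) * ENNReal.ofReal (2 ^ ((n : ℝ) * k))) *
        (ENNReal.ofReal (((2 : ℝ) ^ (j : ℤ)) ^ (2 * α)) *
          ∫⁻ z in (I.expand _ (hr k)).toSet, ‖lpOp ψ j f z‖ₑ ^ 2) := by
        refine ENNReal.tsum_le_tsum fun j => ?_
        refine (mul_le_mul_right (hsingle j) _).trans (le_of_eq ?_)
        rw [← ENNReal.tsum_mul_left, ← ENNReal.tsum_mul_left]
        refine tsum_congr fun k => ?_
        ring
    _ = ∑' k : ℕ, C₁ * C₂ *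
        (ENNReal.ofReal ((2 : ℝ) ^ (-N * k)) * ENNReal.ofReal (2 ^ ((n : ℝ) * k))) *
        ∑' j : {j : ℤ // 1 ≤ (2 : ℝ) ^ j * I.side}, (ENNReal.ofReal (((2 : ℝ) ^ (j : ℤ)) ^ (2 * α)) *
          ∫⁻ z in (I.expand _ (hr k)).toSet, ‖lpOp ψ j f z‖ₑ ^ 2) := by
        rw [ENNReal.tsum_comm]
        simp_rw [ENNReal.tsum_mul_left]
    _ ≤ ∑' k : ℕ, C₁ * C₂ *
        (ENNReal.ofReal ((2 : ℝ) ^ (-N * k)) * ENNReal.ofReal (2 ^ ((n : ℝ) * k))) *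
        (ENNReal.ofReal (3 ^ n * 2 ^ ((n : ℝ) * k)) *
        (ENNReal.ofReal (I.side ^ ((n : ℝ) - 2 * α)) * lpSq ψ α f)) := by
        refine ENNReal.tsum_le_tsum fun k => ?_
        gcongr _ * ?_
        exact tsum_dyadic_expand_le_lpSq hα ψ f I k (hr k)
    _ = _ := by
        rw [ENNReal.coe_mul, ENNReal.coe_mul, ENNReal.coe_toNNReal hS.ne, mul_assoc _ _ (_ * _),
          ← ENNReal.tsum_mul_left (a := ENNReal.ofReal (3 ^ n)), ← ENNReal.tsum_mul_right,
          ← ENNReal.tsum_mul_left]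
        refine tsum_congr fun k => ?_
        rw [ENNReal.ofReal_mul (by positivity),
          show -(N - 2 * n) * (k : ℝ) = -N * k + n * k + n * k by ring, ← ofReal_two_rpow_mul,
          ← ofReal_two_rpow_mul]
        ring

/-! ### Q norm bounded by the Littlewood-Paley norm -/

/-- The singular kernel `‖h‖ ^ (-n) * min ((l ‖h‖) ^ (-a)) ((l ‖h‖) ^ b)`. -/
noncomputable def annularKernel (a b l : ℝ) (h : E n) : ℝ≥0∞ :=
  ENNReal.ofReal (‖h‖ ^ (-(n : ℝ)) * min ((l * ‖h‖) ^ (-a)) ((l * ‖h‖) ^ b))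

theorem measurable_annularKernel (a b l : ℝ) :
    Measurable (annularKernel a b l : E n → ℝ≥0∞) :=
  ((measurable_norm.pow_const _).mul (((measurable_norm.const_mul l).pow_const _).min
    ((measurable_norm.const_mul l).pow_const _))).ennreal_ofReal

theorem annularKernel_sub_comm (a b l : ℝ) (x y : E n) :
    annularKernel a b l (x - y) = annularKernel a b l (y - x) := by
  rw [annularKernel, annularKernel, norm_sub_rev]

/-- The bound by a constant is the integral over all of space. For the power, ‖x-y‖ ≤ d = n·side
gives (l‖x-y‖)^b ≤ (l d)^b (‖x-y‖/d)^b, and the last factor belongs to the same kernel at scale 1/d.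
-/
theorem exists_lintegral_annularKernel_le (hn : 1 ≤ n) {a b : ℝ} (ha : 0 < a) (hb : 0 < b) :
    ∃ C : ℝ≥0, ∀ (I : Cube n) (l : ℝ), 0 < l → ∀ x ∈ I.toSet,
      ∫⁻ y in I.toSet, annularKernel a b l (x - y) ≤
        C * ENNReal.ofReal (min 1 ((l * I.side) ^ b)) := by
  obtain ⟨C₁, h₁⟩ := lintegral_norm_rpow_neg_mul_min_le hn ha hb
  obtain ⟨C₂, h₂⟩ := lintegral_norm_rpow_neg_mul_min_le hn one_pos hb
  refine ⟨C₁ + Real.toNNReal ((n : ℝ) ^ b) * C₂, fun I l hl x hx => ?_⟩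
  have hn0 : (0 : ℝ) < n := by exact_mod_cast hn
  have hs := I.side_pos
  have hfirst : ∫⁻ y in I.toSet, annularKernel a b l (x - y) ≤ C₁ := by
    refine (setLIntegral_le_lintegral _ _).trans ?_
    rw [lintegral_sub_left_eq_self (annularKernel a b l) x]
    exact h₁ l hl
  have hsecond : ∫⁻ y in I.toSet, annularKernel a b l (x - y) ≤
      Real.toNNReal ((n : ℝ) ^ b) * C₂ * ENNReal.ofReal ((l * I.side) ^ b) := by
    set d : ℝ := n * I.side with hd
    have hd0 : 0 < d := by positivity
    calc _ ≤ ∫⁻ y in I.toSet, ENNReal.ofReal ((l * d) ^ b) *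
          annularKernel 1 b d⁻¹ (x - y) := by
          refine setLIntegral_mono' I.measurableSet_toSet fun y hy => ?_
          rw [annularKernel, annularKernel, ← ENNReal.ofReal_mul (by positivity)]
          apply ENNReal.ofReal_le_ofReal
          have hle : ‖x - y‖ ≤ d := Cube.norm_sub_le hx hy
          rcases (norm_nonneg (x - y)).eq_or_lt with h0 | h0
          · rw [← h0, Real.zero_rpow (by linarith)]
            simp
          rw [mul_left_comm]
          gcongr _ * ?_
          set t := d⁻¹ * ‖x - y‖ with ht
          have ht0 : 0 < t := by positivity
          have ht1 : t ≤ 1 := by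
            rw [ht, inv_mul_le_iff₀ hd0]; linarith
          have hmin : min (t ^ (-1 : ℝ)) (t ^ b) = t ^ b := by
            apply min_eq_right
            exact Real.rpow_le_rpow_of_exponent_ge ht0 ht1 (by linarith)
          rw [hmin, ← Real.mul_rpow (by positivity) ht0.le]
          refine (min_le_right _ _).trans (le_of_eq ?_)
          congr 1
          rw [ht]
          field_simp
      _ ≤ ENNReal.ofReal ((l * d) ^ b) * ∫⁻ y, annularKernel 1 b d⁻¹ (x - y) := by
          rw [lintegral_const_mul' _ _ ENNReal.ofReal_ne_top]
          gcongr
          exact Measure.restrict_le_self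
      _ ≤ ENNReal.ofReal ((l * d) ^ b) * C₂ := by
          gcongr
          rw [lintegral_sub_left_eq_self (annularKernel 1 b d⁻¹) x]
          exact h₂ _ (by positivity)
      _ = _ := by
          rw [hd, show l * (n * I.side) = n * (l * I.side) by ring,
            Real.mul_rpow hn0.le (by positivity), ENNReal.ofReal_mul (by positivity),
            ← ENNReal.ofReal.eq_1]
          ring
  push_cast
  rcases min_choice 1 ((l * I.side) ^ b) with h | h
  · rw [h, ENNReal.ofReal_one, mul_one]
    exact hfirst.trans le_self_add
  · rw [h]
    refine hsecond.trans ?_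
    gcongr
    exact le_add_self

theorem min_one_eq_rpow_mul_min {s α : ℝ} (hs : 0 < s) :
    min 1 s = s ^ α * min (s ^ (-α)) (s ^ (1 - α)) := by
  rw [mul_min_of_nonneg _ _ (by positivity), ← Real.rpow_add hs, ← Real.rpow_add hs]
  simp

theorem add_sq_le_two_mul (a b : ℝ≥0∞) : (a + b) ^ 2 ≤ 2 * (a ^ 2 + b ^ 2) := by
  have := ENNReal.rpow_add_le_mul_rpow_add_rpow a b (p := 2) (by norm_num)
  norm_num at this
  exact this

/-- After min(1,s) = s^α min(s^(-α), s^(1-α)), the factor ‖h‖^α comes out of the sum and cancels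
‖h‖^(2α) in the denominator. Cauchy-Schwarz in j with the minimum as weight then leaves exactly
`annularKernel`. -/
theorem exists_sq_tsum_min_le {α : ℝ} (hα₀ : 0 < α) (hα₁ : α < 1) :
    ∃ C : ℝ≥0, ∀ (h : E n), h ≠ 0 → ∀ A : ℤ → ℝ≥0∞,
      (∑' j : ℤ, ENNReal.ofReal (min 1 (2 ^ j * ‖h‖)) * A j) ^ 2 /
        ENNReal.ofReal (‖h‖ ^ (2 * α + n)) ≤
      C * ∑' j : ℤ, ENNReal.ofReal (((2 : ℝ) ^ j) ^ (2 * α)) *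
        (annularKernel α (1 - α) (2 ^ j) h * A j ^ 2) := by
  obtain ⟨C, hC⟩ := tsum_min_rpow_le hα₀ (sub_pos.2 hα₁)
  refine ⟨C, fun h hh A => ?_⟩
  have hr : 0 < ‖h‖ := norm_pos_iff.2 hh
  set r := ‖h‖ with hr_def
  set w : ℤ → ℝ := fun j => min ((2 ^ j * r) ^ (-α)) ((2 ^ j * r) ^ (1 - α)) with hw
  have hw0 : ∀ j, 0 ≤ w j := fun j => by positivity
  have e1 : ∀ j : ℤ, ENNReal.ofReal (min 1 (2 ^ j * r)) * A j =
      ENNReal.ofReal (r ^ α) * (ENNReal.ofReal (w j) *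
        (ENNReal.ofReal (((2 : ℝ) ^ j) ^ α) * A j)) := fun j => by
    rw [min_one_eq_rpow_mul_min (α := α) (by positivity), Real.mul_rpow (by positivity) hr.le,
      ENNReal.ofReal_mul (by positivity), ENNReal.ofReal_mul (by positivity)]
    ring
  have hpos : 0 < r ^ (2 * α + n) := by positivity
  simp_rw [e1, ENNReal.tsum_mul_left]
  rw [mul_pow, ENNReal.div_le_iff (by simpa using hpos) ENNReal.ofReal_ne_top]
  calc _ ≤ ENNReal.ofReal (r ^ α) ^ 2 * ((∑' j, ENNReal.ofReal (w j)) *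
        ∑' j, ENNReal.ofReal (w j) * (ENNReal.ofReal (((2 : ℝ) ^ j) ^ α) * A j) ^ 2) := by
        gcongr
        exact sq_tsum_mul_le _ _
    _ ≤ ENNReal.ofReal (r ^ α) ^ 2 * (C *
        ∑' j, ENNReal.ofReal (w j) * (ENNReal.ofReal (((2 : ℝ) ^ j) ^ α) * A j) ^ 2) := by
        gcongr
        exact hC r hr
    _ = _ := by
        rw [mul_left_comm, mul_assoc (C : ℝ≥0∞), ← ENNReal.tsum_mul_left,
          ← ENNReal.tsum_mul_right]
        congr 1
        refine tsum_congr fun j => ?_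
        rw [annularKernel, ← hr_def, ENNReal.ofReal_mul (by positivity), mul_pow,
          ← ENNReal.ofReal_pow (by positivity), ← ENNReal.ofReal_pow (by positivity),
          ← Real.rpow_natCast (r ^ α), ← Real.rpow_mul hr.le, ← Real.rpow_natCast (_ ^ α),
          ← Real.rpow_mul (by positivity), Real.rpow_add hr, ENNReal.ofReal_mul (by positivity),
          mul_comm α, Nat.cast_ofNat]
        have h1 : ENNReal.ofReal (r ^ (-(n : ℝ))) * ENNReal.ofReal (r ^ (n : ℝ)) = 1 := by
          rw [← ENNReal.ofReal_mul (by positivity), ← Real.rpow_add hr]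
          simp
        calc _ = ENNReal.ofReal (r ^ (2 * α)) * (ENNReal.ofReal (w j) *
              (ENNReal.ofReal (((2 : ℝ) ^ j) ^ (2 * α)) * A j ^ 2)) * 1 := by ring
          _ = _ := by rw [← h1]; ring

theorem exists_enorm_sub_sq_div_le (hn : 1 ≤ n) {α : ℝ} (hα₀ : 0 < α) (hα₁ : α < 1)
    {ψ : 𝓢(E n, ℂ)} (hψ : IsLittlewoodPaley ψ) {N : ℝ} (hN : 0 ≤ N) :
    ∃ C : ℝ≥0, ∀ f : E n → ℂ, Measurable f → MemLp f 2 → ∃ G : Set (E n), (∀ᵐ x, x ∈ G) ∧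
      ∀ x ∈ G, ∀ y ∈ G, ‖f x - f y‖ₑ ^ 2 / ENNReal.ofReal (‖x - y‖ ^ (2 * α + n)) ≤
        C * ∑' j : ℤ, ENNReal.ofReal (((2 : ℝ) ^ j) ^ (2 * α)) *
          (annularKernel α (1 - α) (2 ^ j) (x - y) *
            (lpAvg ψ N j f x ^ 2 + lpAvg ψ N j f y ^ 2)) := by
  obtain ⟨C₁, h₁⟩ := exists_enorm_lpOp_sub_le hψ hN
  obtain ⟨C₂, h₂⟩ := exists_sq_tsum_min_le (n := n) hα₀ hα₁
  refine ⟨C₁ ^ 2 * C₂ * 2, fun f hfm hf => ?_⟩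
  obtain ⟨G, hG, hfG⟩ := ae_forall_enorm_sub_le_tsum hn hψ hfm hf
  refine ⟨G, hG, fun x hx y hy => ?_⟩
  rcases eq_or_ne x y with rfl | hxy
  · simp
  have hle : ‖f x - f y‖ₑ ≤ C₁ * ∑' j : ℤ, ENNReal.ofReal (min 1 (2 ^ j * ‖x - y‖)) *
      (lpAvg ψ N j f x + lpAvg ψ N j f y) := by
    rw [← ENNReal.tsum_mul_left]
    exact (hfG x hx y hy).trans (ENNReal.tsum_le_tsum fun j => h₁ f hfm hf j x y)
  calc _ ≤ (C₁ * ∑' j : ℤ, ENNReal.ofReal (min 1 (2 ^ j * ‖x - y‖)) *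
        (lpAvg ψ N j f x + lpAvg ψ N j f y)) ^ 2 / ENNReal.ofReal (‖x - y‖ ^ (2 * α + n)) := by
        gcongr
    _ ≤ C₁ ^ 2 * (C₂ * ∑' j : ℤ, ENNReal.ofReal (((2 : ℝ) ^ j) ^ (2 * α)) *
        (annularKernel α (1 - α) (2 ^ j) (x - y) *
          (lpAvg ψ N j f x + lpAvg ψ N j f y) ^ 2)) := by
        rw [mul_pow, mul_div_assoc]
        gcongr
        exact h₂ _ (sub_ne_zero.2 hxy) _
    _ ≤ C₁ ^ 2 * (C₂ * ∑' j : ℤ, ENNReal.ofReal (((2 : ℝ) ^ j) ^ (2 * α)) *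
        (annularKernel α (1 - α) (2 ^ j) (x - y) *
          (2 * (lpAvg ψ N j f x ^ 2 + lpAvg ψ N j f y ^ 2)))) := by
        gcongr with j
        exact add_sq_le_two_mul _ _
    _ = _ := by
        push_cast
        rw [mul_assoc, mul_assoc, ← ENNReal.tsum_mul_left (a := (2 : ℝ≥0∞))]
        congr 2
        refine tsum_congr fun j => ?_
        ring

/-- As in Schur's test: the kernel is symmetric, so the A x and A y parts have equal integrals. -/
theorem lintegral_lintegral_annularKernel_mul_le {a b l : ℝ} {A : E n → ℝ≥0∞}
    (hA : Measurable A) (I : Cube n) {B : ℝ≥0∞}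
    (hB : ∀ x ∈ I.toSet, ∫⁻ y in I.toSet, annularKernel a b l (x - y) ≤ B) :
    ∫⁻ x in I.toSet, ∫⁻ y in I.toSet, annularKernel a b l (x - y) * (A x + A y) ≤
      2 * B * ∫⁻ x in I.toSet, A x := by
  have hk : Measurable fun p : E n × E n => annularKernel a b l (p.1 - p.2) :=
    (measurable_annularKernel a b l).comp (measurable_fst.sub measurable_snd)
  have hkx : ∀ x : E n, Measurable fun y : E n => annularKernel a b l (x - y) := fun x =>
    (measurable_annularKernel a b l).comp (measurable_const.sub measurable_id)
  have hF : Measurable fun p : E n × E n => annularKernel a b l (p.1 - p.2) * A p.1 :=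
    hk.mul (hA.comp measurable_fst)
  have hmain : ∫⁻ x in I.toSet, ∫⁻ y in I.toSet, annularKernel a b l (x - y) * A x ≤
      B * ∫⁻ x in I.toSet, A x := by
    rw [← lintegral_const_mul _ hA]
    refine setLIntegral_mono' I.measurableSet_toSet fun x hx => ?_
    rw [lintegral_mul_const _ (hkx x)]
    gcongr
    exact hB x hx
  have hswap : ∫⁻ x in I.toSet, ∫⁻ y in I.toSet, annularKernel a b l (x - y) * A y =
      ∫⁻ x in I.toSet, ∫⁻ y in I.toSet, annularKernel a b l (x - y) * A x := by
    rw [lintegral_lintegral_swap (hk.mul (hA.comp measurable_snd)).aemeasurable]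
    refine lintegral_congr fun x => lintegral_congr fun y => ?_
    rw [annularKernel_sub_comm]
  simp_rw [mul_add]
  have hsplit : ∀ x, ∫⁻ y in I.toSet, (annularKernel a b l (x - y) * A x +
      annularKernel a b l (x - y) * A y) = (∫⁻ y in I.toSet, annularKernel a b l (x - y) * A x) +
      ∫⁻ y in I.toSet, annularKernel a b l (x - y) * A y := fun x =>
    lintegral_add_left ((hkx x).mul_const _) _
  simp_rw [hsplit]
  rw [lintegral_add_left hF.lintegral_prod_right', hswap, two_mul, add_mul]
  gcongr

/-- The factor min(1, (2^j l)^(1-α)) supplies decay at low frequencies and is harmless at high ones.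
-/
theorem exists_lintegral_cube_le_tsum (hn : 1 ≤ n) {α : ℝ} (hα₀ : 0 < α) (hα₁ : α < 1)
    {ψ : 𝓢(E n, ℂ)} (hψ : IsLittlewoodPaley ψ) {N : ℝ} (hN : 0 ≤ N) :
    ∃ C : ℝ≥0, ∀ f : E n → ℂ, Measurable f → MemLp f 2 → ∀ I : Cube n,
      ∫⁻ x in I.toSet, ∫⁻ y in I.toSet,
        ‖f x - f y‖ₑ ^ 2 / ENNReal.ofReal (‖x - y‖ ^ (2 * α + n)) ≤
      C * ∑' j : ℤ, ENNReal.ofReal (((2 : ℝ) ^ j) ^ (2 * α)) *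
        (ENNReal.ofReal (min 1 ((2 ^ j * I.side) ^ (1 - α))) *
          ∫⁻ x in I.toSet, lpAvg ψ N j f x ^ 2) := by
  obtain ⟨C₁, h₁⟩ := exists_enorm_sub_sq_div_le hn hα₀ hα₁ hψ hN
  obtain ⟨C₂, h₂⟩ := exists_lintegral_annularKernel_le hn hα₀ (sub_pos.2 hα₁)
  refine ⟨C₁ * (2 * C₂), fun f hfm hf I => ?_⟩
  obtain ⟨G, hG, hfG⟩ := h₁ f hfm hf
  have hA : ∀ j : ℤ, Measurable fun x => lpAvg ψ N j f x ^ 2 := fun j =>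
    (measurable_lpAvg ψ N j hfm).pow_const 2
  set F : ℤ → E n × E n → ℝ≥0∞ := fun j p => annularKernel α (1 - α) (2 ^ j) (p.1 - p.2) *
    (lpAvg ψ N j f p.1 ^ 2 + lpAvg ψ N j f p.2 ^ 2) with hF
  have hFm : ∀ j, Measurable (F j) := fun j =>
    ((measurable_annularKernel α (1 - α) (2 ^ j)).comp (measurable_fst.sub measurable_snd)).mul
      (((hA j).comp measurable_fst).add ((hA j).comp measurable_snd))
  have hFx : ∀ j x, Measurable fun y => F j (x, y) := fun j x =>
    (hFm j).comp (measurable_const.prodMk measurable_id)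
  calc _ ≤ ∫⁻ x in I.toSet, ∫⁻ y in I.toSet, C₁ * ∑' j : ℤ,
        ENNReal.ofReal (((2 : ℝ) ^ j) ^ (2 * α)) * F j (x, y) := by
        refine lintegral_mono_ae ?_
        filter_upwards [ae_restrict_of_ae hG] with x hx
        refine lintegral_mono_ae ?_
        filter_upwards [ae_restrict_of_ae hG] with y hy
        exact hfG x hx y hy
    _ = C₁ * ∑' j : ℤ, ENNReal.ofReal (((2 : ℝ) ^ j) ^ (2 * α)) *
        ∫⁻ x in I.toSet, ∫⁻ y in I.toSet, F j (x, y) := by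
        simp_rw [lintegral_const_mul' _ _ ENNReal.coe_ne_top]
        congr 1
        have hin : ∀ x, ∫⁻ y in I.toSet, ∑' j : ℤ,
            ENNReal.ofReal (((2 : ℝ) ^ j) ^ (2 * α)) * F j (x, y) =
            ∑' j : ℤ, ENNReal.ofReal (((2 : ℝ) ^ j) ^ (2 * α)) * ∫⁻ y in I.toSet, F j (x, y) :=
          fun x => lintegral_tsum_const_mul (fun j => ENNReal.ofReal_ne_top) fun j => hFx j x
        simp_rw [hin]
        exact lintegral_tsum_const_mul (fun j => ENNReal.ofReal_ne_top)
          fun j => (hFm j).lintegral_prod_right'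
    _ ≤ C₁ * ∑' j : ℤ, ENNReal.ofReal (((2 : ℝ) ^ j) ^ (2 * α)) *
        (2 * (C₂ * ENNReal.ofReal (min 1 ((2 ^ j * I.side) ^ (1 - α)))) *
          ∫⁻ x in I.toSet, lpAvg ψ N j f x ^ 2) := by
        refine mul_le_mul_right (ENNReal.tsum_le_tsum fun j => mul_le_mul_right ?_ _) _
        exact lintegral_lintegral_annularKernel_mul_le (hA j) I
          fun x hx => h₂ I _ (by positivity) x hx
    _ = _ := by
        push_cast
        rw [mul_assoc, ← ENNReal.tsum_mul_left (a := 2 * (C₂ : ℝ≥0∞))]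
        congr 1
        refine tsum_congr fun j => ?_
        ring

theorem exists_qSq_le_lpSq (hn : 1 ≤ n) {α : ℝ} (hα₀ : 0 < α) (hα₁ : α < 1)
    {ψ : 𝓢(E n, ℂ)} (hψ : IsLittlewoodPaley ψ) :
    ∃ C : ℝ≥0, ∀ f : E n → ℂ, Measurable f → MemLp f 2 → qSq α f ≤ C * lpSq ψ α f := by
  have hn0 : (0 : ℝ) ≤ n := Nat.cast_nonneg n
  obtain ⟨C₁, h₁⟩ := exists_lintegral_cube_le_tsum hn hα₀ hα₁ hψ (N := 2 * n + 1) (by linarith)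
  obtain ⟨C₂, h₂⟩ := exists_tsum_lintegral_lpAvg_sq_le ψ hα₀ (N := 2 * n + 1) (by linarith)
  obtain ⟨C₃, h₃⟩ := exists_lpAvg_sq_le_lpSq ψ hα₀ (N := 2 * n + 1) (by linarith)
  -- At low frequencies 2^(2αj) l^n (2^j l)^(1-α) equals l^(n-2α) (2^j l)^(2α+(1-α)). The other
  -- exponent 1 is arbitrary, as only terms with 2^j l < 1 are used.
  obtain ⟨C₄, h₄⟩ := tsum_min_rpow_le one_pos (by linarith : 0 < 2 * α + (1 - α))
  refine ⟨C₁ * (C₂ + C₃ * C₄), fun f hfm hf => iSup_le fun I => ?_⟩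
  rw [← neg_sub (n : ℝ)]
  refine ofReal_rpow_neg_mul_le I.side_pos ((h₁ f hfm hf I).trans ?_)
  have hl := I.side_pos
  set J : Set ℤ := {j : ℤ | 1 ≤ (2 : ℝ) ^ j * I.side} with hJ
  set T : ℤ → ℝ≥0∞ := fun j => ENNReal.ofReal (((2 : ℝ) ^ j) ^ (2 * α)) *
    ∫⁻ x in I.toSet, lpAvg ψ (2 * n + 1) j f x ^ 2 with hT
  set X : ℝ≥0∞ := ENNReal.ofReal (I.side ^ ((n : ℝ) - 2 * α)) * lpSq ψ α f with hX
  have hterm : ∀ j : ℤ, ENNReal.ofReal (((2 : ℝ) ^ j) ^ (2 * α)) *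
      (ENNReal.ofReal (min 1 ((2 ^ j * I.side) ^ (1 - α))) *
        ∫⁻ x in I.toSet, lpAvg ψ (2 * n + 1) j f x ^ 2) ≤
      J.indicator T j + C₃ * X * ENNReal.ofReal (min ((2 ^ j * I.side) ^ (-1 : ℝ))
        ((2 ^ j * I.side) ^ (2 * α + (1 - α)))) := by
    intro j
    have hj0 : (0 : ℝ) < 2 ^ j := by positivity
    by_cases hj : 1 ≤ (2 : ℝ) ^ j * I.side
    · rw [Set.indicator_of_mem (by exact hj)]
      refine le_trans ?_ le_self_add
      simp only [hT]
      gcongr _ * ?_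
      refine mul_le_of_le_one_left' ?_
      rw [ENNReal.ofReal_le_one]
      exact min_le_left _ _
    · rw [Set.indicator_of_notMem (by exact hj), zero_add]
      rw [not_le] at hj
      have hs0 : 0 < (2 : ℝ) ^ j * I.side := by positivity
      have hmin : min (((2 : ℝ) ^ j * I.side) ^ (-1 : ℝ))
          (((2 : ℝ) ^ j * I.side) ^ (2 * α + (1 - α))) =
          ((2 : ℝ) ^ j * I.side) ^ (2 * α + (1 - α)) := by
        apply min_eq_right
        exact Real.rpow_le_rpow_of_exponent_ge hs0 hj.le (by linarith)
      rw [hmin]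
      calc _ ≤ ENNReal.ofReal (((2 : ℝ) ^ j) ^ (2 * α)) *
            (ENNReal.ofReal ((2 ^ j * I.side) ^ (1 - α)) *
              (C₃ * lpSq ψ α f * ENNReal.ofReal (I.side ^ n))) := by
            gcongr
            · exact min_le_right _ _
            · rw [← I.volume_toSet, ← setLIntegral_const]
              exact lintegral_mono fun x => h₃ f hfm j x
        _ = _ := by
            have e : ((2 : ℝ) ^ j) ^ (2 * α) * I.side ^ n =
                I.side ^ ((n : ℝ) - 2 * α) * ((2 : ℝ) ^ j * I.side) ^ (2 * α) := by
              rw [Real.mul_rpow hj0.le hl.le, mul_left_comm, ← Real.rpow_add hl, sub_add_cancel,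
                Real.rpow_natCast]
            have e' := congrArg ENNReal.ofReal e
            rw [ENNReal.ofReal_mul (by positivity), ENNReal.ofReal_mul (by positivity)] at e'
            rw [hX, Real.rpow_add hs0, ENNReal.ofReal_mul (by positivity)]
            calc _ = (ENNReal.ofReal (((2 : ℝ) ^ j) ^ (2 * α)) * ENNReal.ofReal (I.side ^ n)) *
                  (ENNReal.ofReal ((2 ^ j * I.side) ^ (1 - α)) * (C₃ * lpSq ψ α f)) := by ring
              _ = _ := by rw [e']; ring
  calc _ ≤ C₁ * ∑' j : ℤ, (J.indicator T j + C₃ * X *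
        ENNReal.ofReal (min ((2 ^ j * I.side) ^ (-1 : ℝ))
          ((2 ^ j * I.side) ^ (2 * α + (1 - α))))) :=
        mul_le_mul_right (ENNReal.tsum_le_tsum hterm) _
    _ ≤ C₁ * (C₂ * X + C₃ * X * C₄) := by
        rw [ENNReal.tsum_add, ENNReal.tsum_mul_left, ← tsum_subtype]
        refine mul_le_mul_right (add_le_add (h₂ f hfm I) (mul_le_mul_right (h₄ _ hl) _)) _
    _ = _ := by
        push_cast
        ring

/-! ### Measurable representatives and the final equivalence -/

theorem qNorm_congr_ae (α : ℝ) {f g : E n → ℂ} (h : f =ᵐ[volume] g) :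
    qNorm α f = qNorm α g := by
  rw [qNorm, qNorm]
  congr 1
  refine iSup_congr fun I => ?_
  congr 1
  refine lintegral_congr_ae ?_
  filter_upwards [ae_restrict_of_ae h] with x hx
  refine lintegral_congr_ae ?_
  filter_upwards [ae_restrict_of_ae h] with y hy
  rw [hx, hy]

theorem lpNorm_congr_ae (ψ : 𝓢(E n, ℂ)) (α : ℝ) {f g : E n → ℂ} (h : f =ᵐ[volume] g) :
    lpNorm ψ α f = lpNorm ψ α g := by
  simp only [lpNorm, lpOp_congr_ae ψ _ h]

theorem rpow_half_le {A B : ℝ≥0∞} {C : ℝ≥0} (h : A ≤ C * B) :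
    A ^ (1 / 2 : ℝ) ≤ (C ^ (1 / 2 : ℝ) : ℝ≥0) * B ^ (1 / 2 : ℝ) := by
  rw [ENNReal.coe_rpow_of_nonneg _ (by norm_num), ← ENNReal.mul_rpow_of_nonneg _ _ (by norm_num)]
  exact ENNReal.rpow_le_rpow h (by norm_num)

theorem exists_qNorm_lpNorm_equivalent (hn : 1 ≤ n) {α : ℝ} (hα₀ : 0 < α) (hα₁ : α < 1)
    {ψ : 𝓢(E n, ℂ)} (hψ : IsLittlewoodPaley ψ) :
    ∃ C : ℝ≥0, 0 < C ∧ ∀ f : E n → ℂ, MemLp f 2 volume →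
      qNorm α f ≤ C * lpNorm ψ α f ∧ lpNorm ψ α f ≤ C * qNorm α f := by
  obtain ⟨C₁, h₁⟩ := exists_qSq_le_lpSq hn hα₀ hα₁ hψ
  obtain ⟨C₂, h₂⟩ := exists_lpSq_le_qSq hα₀ hψ
  -- The summand 1 only makes the constant positive.
  refine ⟨C₁ ^ (1 / 2 : ℝ) + C₂ ^ (1 / 2 : ℝ) + 1, by positivity, fun f hf => ?_⟩
  -- Both norms depend only on the class of f almost everywhere, so f may be replaced by a Borel
  -- representative, as the estimates require.
  obtain ⟨g, hgm, hfg⟩ := hf.1.aemeasurable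
  have hg : MemLp g 2 volume := (memLp_congr_ae hfg).1 hf
  rw [qNorm_congr_ae α hfg, lpNorm_congr_ae ψ α hfg, qNorm_eq, lpNorm_eq hn]
  constructor
  · refine (rpow_half_le (h₁ g hgm hg)).trans ?_
    gcongr
    rw [add_assoc]
    exact le_self_add
  · refine (rpow_half_le (h₂ g hgm hg)).trans ?_
    gcongr
    rw [add_right_comm]
    exact le_add_self

end QSpace

theorem mainTheorem1 (n : ℕ) (hn : 1 ≤ n) (α : ℝ) (hα₀ : 0 < α) (hα₁ : α < 1)
    (ψ : 𝓢(QSpace.E n, ℂ)) (hψ : QSpace.IsLittlewoodPaley ψ) :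
    (∃ C : ℝ≥0, 0 < C ∧
      ∀ f : QSpace.E n → ℂ, MeasureTheory.MemLp f 2 MeasureTheory.volume →
        QSpace.qNorm α f ≤ C * QSpace.lpNorm ψ α f ∧
        QSpace.lpNorm ψ α f ≤ C * QSpace.qNorm α f) ∧
    QSpace.qSpaceL2 n α = QSpace.lpSpaceL2 ψ α := by
  obtain ⟨C, hC, h⟩ := QSpace.exists_qNorm_lpNorm_equivalent hn hα₀ hα₁ hψ
  refine ⟨⟨C, hC, h⟩, ?_⟩
  ext f
  constructor
  · rintro ⟨hf, hq⟩
    exact ⟨hf, (h f hf).2.trans_lt (ENNReal.mul_lt_top ENNReal.coe_lt_top hq)⟩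
  · rintro ⟨hf, hq⟩
    exact ⟨hf, (h f hf).1.trans_lt (ENNReal.mul_lt_top ENNReal.coe_lt_top hq)⟩
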